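/- Consider the symmetric linear deterministic (LD) interference relay channel with nonnegative integer strengths $n_d$ (direct links), $n_c$ (cross links), $n_r$ (relay–destination links), $n_s$ (source–relay links). Put $q=\max\{n_d,n_c,n_r,n_s\}$ and let $S$ be the $q\times q$ down-shift matrix over $\mathbb F_2$. In channel use $k$ the relay receives $y_r[k]=S^{q-n_s}x_1[k]\oplus S^{q-n_s}x_2[k]$ and receiver $j$ receives $y_j[k]=S^{q-n_d}x_j[k]\oplus S^{q-n_c}x_l[k]\oplus S^{q-n_r}x_r[k]$, where $l\ne j$, all inputs lie in $\mathbb F_2^q$, $x_r[1]=0$, and $x_r[k]$ is a function of $y_r[1],\dots,y_r[k-1]$. A rate pair $(R_1,R_2)$ with $R_1,R_2\ge 0$ is achievable if there are codes of length $n$ with $\lfloor 2^{nR_i}\rfloor$ messages for user $i$ whose average error probability tends to $0$ as $n\to\infty$; the capacity region is the closure of the set of achievable pairs, and the sum-capacity is the maximum of $R_1+R_2$ over it. **Scheme SI.** The scheme uses $B$ blocks of $L$ channel uses each. The $L$ symbols of a block are interleaved level by level into one vector with $Lq$ levels, on which a link of strength $m$ carries the top $Lm$ levels. In each of the blocks $k=1,\dots,B-1$,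 user $i$ has fresh signals of its own: common signals $u_{i,cm1}[k],u_{i,cm2}[k]$, compute-forward signals $u_{i,cf1}[k],u_{i,cf2}[k]$, decode-forward signals $u_{i,df1}[k],u_{i,df2}[k]$, and neutralization signals $u_{i,cn}[k]=(u_{i,cn1}[k],u_{i,cn2}[k])$, with $R_a$ information bits in signal $a$ (the same numbers for both users). Signals with time index $0$ or $B$ are zero. The signal $cm1$ is encoded, by some map for each user, into a vector of length $\ell_{cm1}$; $u_{i,dfa}$ has length $2R_{dfa}$, the bits of user 1 being in the upper half and those of user 2 in the lower half, the other half being zero; and $R_{cn1}=2R_{df1}$. In block $k$ user $i$ sends, from top to bottom and padded by zeros, $$u_{i,cm1}[k],\ u_{i,cm2}[k],\ u_{i,cf1}[k],\ 0_{\ell_1},\ u_{i,cf2}[k],\ u_{i,cn1}[k-1]\oplus u_{i,df1}[k],\ u_{i,cn2}[k-1],\ u_{i,df2}[k],\ u_{i,cn}[k],$$ of total length at most $Ln_s$, and the relay sends $$0_{\ell_2},\ u_{r,df1},\ u_{r,df2},\ u_{r,cf1},\ u_{r,cf2},\ 0_{\ell_3},\ u_{r,cn1},\ u_{r,cn2},\qquad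 u_{r,a}=u_{1,a}[k-1]\oplus u_{2,a}[k-1],$$ of total length at most $Ln_r$. The relay's signal $u_{r,cn}$ arrives at each receiver on the same levels as the undesired user's $u_{cn}[k-1]$, so that this interference is neutralized. Each receiver can recover the common signals of both users. **Proposition.** Let $n_d<n_c<n_s$ (strong interference, source–relay links stronger than the cross links), and let $$R_\Sigma=\min\{2\max\{n_d,n_r\},\ \max\{n_r,n_c\}+(n_s-n_c),\ n_s+n_c,\ n_c+n_r\}.$$ 1. Scheme SI achieves the sum-rate $R_\Sigma$: there are $L\ge 1$ and a choice of its parameters with $2\sum_a R_a=L\,R_\Sigma$ such that for every $B\ge1$ the resulting code of length $n=BL$, with $2^{(B-1)\sum_a R_a}$ messages per user, is decoded without error. Its sum-rate is thus $\frac{B-1}{B}R_\Sigma$, which tends to $R_\Sigma$ as $B\to\infty$. 2. $R_\Sigma$ is optimal: it is the sum-capacity of the channel. It is the least of the following upper bounds: $\max\{n_d,\min\{n_r,n_s\}\}$ (only if $n_d=n_c$); $\max\{n_d,n_c,n_r\}+\max\{n_d,n_c\}$; $n_r+2\max\{n_d,n_c\}-n_c$; $\max\{n_d,n_c\}+\max\{n_d,n_s\}$;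 $2\max\{n_c,n_r,n_d-\max\{n_c,n_s\}\}+2(n_s-n_c)^+$; $2\max\{n_c,n_r+n_d-n_c\}$ (only if $n_r\le n_c\le n_d$); $2\max\{n_d,n_r\}$; $\max\{n_d,n_r,n_c\}+\max\{n_d,n_c\}-n_c+(n_s-\max\{n_d,n_c\})^+$. It also equals $$\min\left\{\begin{array}{l}2\max\{n_d,n_r\},\\ \max\{n_d,n_c,n_r\}+\max\{n_d,n_c\}-\bigl(n_c-(n_s-\max\{n_d,n_c\})^+\bigr)^+,\\ n_r+2\max\{n_d,n_c\}-n_c,\\ 2\max\{n_s,\,n_r+n_s-n_c,\,n_d-n_c\},\\ \max\{n_d,n_c\}+\max\{n_d,n_s\},\\ 2\max\{n_c,\,n_r+(n_d-n_c)^+\}\end{array}\right\}.$$ -/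

import Mathlib

open Filter Topology

/-! ### The linear deterministic interference relay channel -/

/-- The channel strengths of the symmetric linear deterministic interference relay channel:
direct links `nd`, cross links `nc`, relay-destination links `nr`, source-relay links `ns`. -/
structure LDIRC where
  nd : ℕ
  nc : ℕ
  nr : ℕ
  ns : ℕ

namespace LDIRC

/-- The number `q = max {nd, nc, nr, ns}` of bit levels. -/
def q (p : LDIRC) : ℕ := max (max p.nd p.nc) (max p.nr p.ns)

/-- A channel symbol, a column in `𝔽₂^q`; index `0` is the top-most bit. -/
abbrev Vec (p : LDIRC) : Type := Fin p.q → ZMod 2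

/-- The `q × q` down-shift matrix. -/
def shiftMatrix (q : ℕ) : Matrix (Fin q) (Fin q) (ZMod 2) :=
  Matrix.of fun i j => if i.val = j.val + 1 then 1 else 0

/-- Transmission over a link of strength `m`: the vector `S ^ (q - m) x`. -/
def link (p : LDIRC) (m : ℕ) (x : p.Vec) : p.Vec :=
  (shiftMatrix p.q ^ (p.q - m)).mulVec x

/-- A block code of length `n` for the channel; transmitter and receiver `i` have `M i` messages.
The relay symbol at (zero-based) time `k` depends on the relay outputs at times `0, …, k - 1`, and
the relay is silent at time `0`. -/
structure Code (p : LDIRC) (n : ℕ) (M : Fin 2 → ℕ) where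
  enc : (i : Fin 2) → Fin (M i) → Fin n → p.Vec
  relay : (k : Fin n) → (Fin k.val → p.Vec) → p.Vec
  relay_first : ∀ (k : Fin n) (y : Fin k.val → p.Vec), k.val = 0 → relay k y = 0
  dec : (i : Fin 2) → (Fin n → p.Vec) → Fin (M i)

namespace Code

variable {p : LDIRC} {n : ℕ} {M : Fin 2 → ℕ}

/-- The relay output `y_r[k] = S^(q-ns) x_1[k] + S^(q-ns) x_2[k]`. -/
def relayOutput (C : Code p n M) (w : (i : Fin 2) → Fin (M i)) (k : Fin n) : p.Vec :=
  p.link p.ns (C.enc 0 (w 0) k) + p.link p.ns (C.enc 1 (w 1) k)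

/-- The symbol `x_r[k]` that the relay sends. -/
def relayInput (C : Code p n M) (w : (i : Fin 2) → Fin (M i)) (k : Fin n) : p.Vec :=
  C.relay k fun l => C.relayOutput w ⟨l.val, l.isLt.trans k.isLt⟩

/-- The output at receiver `j`; the undesired transmitter is `1 - j`. -/
def output (C : Code p n M) (j : Fin 2) (w : (i : Fin 2) → Fin (M i)) (k : Fin n) : p.Vec :=
  p.link p.nd (C.enc j (w j) k) + p.link p.nc (C.enc (1 - j) (w (1 - j)) k)
    + p.link p.nr (C.relayInput w k)

/-- The average error probability for independent, uniformly distributed messages. -/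
noncomputable def errorProb (C : Code p n M) : ℝ :=
  (Nat.card {w : (i : Fin 2) → Fin (M i) // ∃ j, C.dec j (C.output j w) ≠ w j} : ℝ)
    / ((M 0 : ℝ) * (M 1 : ℝ))

end Code

/-- The rate pair `R` is achievable: there is a sequence of `(n, 2^(n R 0), 2^(n R 1))` codes whose
average error probability tends to zero. -/
def Achievable (p : LDIRC) (R : Fin 2 → ℝ) : Prop :=
  (∀ i, 0 ≤ R i) ∧
    ∃ C : (n : ℕ) → Code p n fun i => ⌊(2 : ℝ) ^ ((n : ℝ) * R i)⌋₊,
      Tendsto (fun n => (C n).errorProb) atTop (𝓝 0)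

/-- The capacity region: the closure of the set of achievable rate pairs. -/
def capacityRegion (p : LDIRC) : Set (Fin 2 → ℝ) := closure {R | p.Achievable R}

/-- The sum-rates of the rate pairs in the capacity region; the sum-capacity is the maximum. -/
def sumRates (p : LDIRC) : Set ℝ := {r | ∃ R ∈ p.capacityRegion, r = R 0 + R 1}

/-! ### Scheme SI -/

/-- The signal streams of each user: common (`cm`), compute-forward (`cf`), decode-forward (`df`)
and cooperative interference neutralization (`cn`). -/
inductive Stream
  | cm1 | cm2 | cf1 | cf2 | df1 | df2 | cn1 | cn2
  deriving DecidableEq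

instance : Fintype Stream where
  elems := {.cm1, .cm2, .cf1, .cf2, .df1, .df2, .cn1, .cn2}
  complete := by intro c; cases c <;> decide

/-- A parameter choice for scheme SI. In every block, each user sends `rate c` information bits in
stream `c`; `l1`, `l2`, `l3` are the lengths of the zero paddings. The first common signal is an
arbitrarily encoded vector of `lcm1` bits. -/
structure SIParams where
  rate : Stream → ℕ
  lcm1 : ℕ
  l1 : ℕ
  l2 : ℕ
  l3 : ℕ
  cmEnc : Fin 2 → (Fin (rate .cm1) → ZMod 2) → (Fin lcm1 → ZMod 2)

namespace SIParams

/-- The information bits of one user in one block. -/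
abbrev Payload (A : SIParams) : Type := (c : Stream) → Fin (A.rate c) → ZMod 2

/-- The number of information bits that each user sends per block. -/
def bits (A : SIParams) : ℕ := ∑ c, A.rate c

/-- The number of levels that a user's signal occupies above its signal
`u_{cn1}[k-1] + u_{df1}[k]`. -/
def txAbove (A : SIParams) : ℕ := A.lcm1 + A.rate .cm2 + A.rate .cf1 + A.l1 + A.rate .cf2

/-- The number of levels of the relay signal above its neutralization signal. -/
def relayAbove (A : SIParams) : ℕ :=
  A.l2 + 2 * A.rate .df1 + 2 * A.rate .df2 + A.rate .cf1 + A.rate .cf2 + A.l3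

/-- The structural constraints of scheme SI when it runs over blocks of `L` channel uses, in which
a link of strength `m` carries `L * m` levels. -/
structure Valid (A : SIParams) (p : LDIRC) (L : ℕ) : Prop where
  /-- The signals `u_{cn1}[k-1]` and `u_{df1}[k]`, which are added, have the same length. -/
  cn1_eq : A.rate .cn1 = 2 * A.rate .df1
  /-- The relay receives all bits of the users' signals. -/
  tx_le : A.txAbove + 2 * A.rate .cn1 + 2 * A.rate .cn2 + 2 * A.rate .df2 ≤ L * p.ns
  /-- The receivers receive all bits of the relay's signal. -/
  relay_le : A.relayAbove + A.rate .cn1 + A.rate .cn2 ≤ L * p.nr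
  /-- Neutralization: at each receiver the relay's `cn` signal arrives on the same levels as the
  undesired user's signal `u_{cn}[k-1]`. -/
  aligned : L * p.nr + A.txAbove = L * p.nc + A.relayAbove

/-- A column vector made of consecutive blocks, each given by its length and its entries, and
continued by zeros. -/
def stack : List (ℕ × (ℕ → ZMod 2)) → ℕ → ZMod 2
  | [], _ => 0
  | (l, u) :: t, j => if j < l then u j else stack t (j - l)

variable (A : SIParams) {B : ℕ}

/-- The signal `u_c[k]` of a user with message `m` in block `k = 1, …, B - 1`; it is zero in the
blocks `0` and `B`. -/
def sig (m : Fin (B - 1) → A.Payload) (c : Stream) (k : ℕ) (j : ℕ) : ZMod 2 :=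
  if h : (1 ≤ k ∧ k - 1 < B - 1) ∧ j < A.rate c then m ⟨k - 1, h.1.2⟩ c ⟨j, h.2⟩ else 0

/-- The encoded first common signal of user `i` in block `k`. -/
def cmSig (i : Fin 2) (m : Fin (B - 1) → A.Payload) (k : ℕ) (j : ℕ) : ZMod 2 :=
  if h : (1 ≤ k ∧ k - 1 < B - 1) ∧ j < A.lcm1 then
    A.cmEnc i (m ⟨k - 1, h.1.2⟩ .cm1) ⟨j, h.2⟩ else 0

/-- The decode-forward signals, of length `2 * rate c`: the bits of the first user are in the upper
half, those of the second user in the lower half. -/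
def dfSig (i : Fin 2) (m : Fin (B - 1) → A.Payload) (c : Stream) (k : ℕ) (j : ℕ) : ZMod 2 :=
  if i = 0 then A.sig m c k j else if j < A.rate c then 0 else A.sig m c k (j - A.rate c)

/-- The vector sent by user `i` in block `k`. -/
def txSignal (i : Fin 2) (m : Fin (B - 1) → A.Payload) (k : ℕ) : ℕ → ZMod 2 :=
  stack
    [(A.lcm1, A.cmSig i m k),
     (A.rate .cm2, A.sig m .cm2 k),
     (A.rate .cf1, A.sig m .cf1 k),
     (A.l1, 0),
     (A.rate .cf2, A.sig m .cf2 k),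
     (A.rate .cn1, A.sig m .cn1 (k - 1) + A.dfSig i m .df1 k),
     (A.rate .cn2, A.sig m .cn2 (k - 1)),
     (2 * A.rate .df2, A.dfSig i m .df2 k),
     (A.rate .cn1, A.sig m .cn1 k),
     (A.rate .cn2, A.sig m .cn2 k)]

/-- The vector sent by the relay in block `k`, made of the sums of the users' signals of block
`k - 1`. -/
def relaySignal (m : Fin 2 → Fin (B - 1) → A.Payload) (k : ℕ) : ℕ → ZMod 2 :=
  stack
    [(A.l2, 0),
     (2 * A.rate .df1, A.dfSig 0 (m 0) .df1 (k - 1) + A.dfSig 1 (m 1) .df1 (k - 1)),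
     (2 * A.rate .df2, A.dfSig 0 (m 0) .df2 (k - 1) + A.dfSig 1 (m 1) .df2 (k - 1)),
     (A.rate .cf1, A.sig (m 0) .cf1 (k - 1) + A.sig (m 1) .cf1 (k - 1)),
     (A.rate .cf2, A.sig (m 0) .cf2 (k - 1) + A.sig (m 1) .cf2 (k - 1)),
     (A.l3, 0),
     (A.rate .cn1, A.sig (m 0) .cn1 (k - 1) + A.sig (m 1) .cn1 (k - 1)),
     (A.rate .cn2, A.sig (m 0) .cn2 (k - 1) + A.sig (m 1) .cn2 (k - 1))]

/-- The code `C`, of length `B * L`, is an instance of scheme SI with parameters `A` and with `B`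
blocks of `L` channel uses. The messages of each user are in bijection with the contents of its
streams in the blocks `1, …, B - 1`. Bit `j` of the symbol in the `r`-th channel use of a block is
bit `j * L + r` of the block's vector, so that a shift by `s` levels of the symbols is a shift by
`L * s` of the vector. Both receivers can recover the common signals of both users. -/
def IsSchemeSI (p : LDIRC) (L B : ℕ) {M : Fin 2 → ℕ} (C : Code p (B * L) M) : Prop :=
  A.Valid p L ∧
  ∃ msg : (i : Fin 2) → Fin (M i) ≃ (Fin (B - 1) → A.Payload),
    (∀ i w (t : Fin (B * L)) (j : Fin p.q),
      C.enc i w t j = A.txSignal i (msg i w) (t.val / L + 1) (j.val * L + t.val % L)) ∧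
    (∀ w (t : Fin (B * L)) (j : Fin p.q),
      C.relayInput w t j =
        A.relaySignal (fun i => msg i (w i)) (t.val / L + 1) (j.val * L + t.val % L)) ∧
    (∀ i w w', C.output i w = C.output i w' → ∀ i' b,
      msg i' (w i') b .cm1 = msg i' (w' i') b .cm1 ∧
      msg i' (w i') b .cm2 = msg i' (w' i') b .cm2)

end SIParams

/-! ### The rate expressions -/

/-- The sum-rate of scheme SI. -/
def siSumRate (p : LDIRC) : ℤ :=
  min (min (2 * max (p.nd : ℤ) p.nr) (max (p.nr : ℤ) p.nc + (p.ns - p.nc)))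
    (min ((p.ns : ℤ) + p.nc) ((p.nc : ℤ) + p.nr))

/-- The upper bounds on the sum-capacity, each in the range of parameters where it applies. -/
def upperBoundExprs (p : LDIRC) : Set ℤ :=
  let nd : ℤ := p.nd
  let nc : ℤ := p.nc
  let nr : ℤ := p.nr
  let ns : ℤ := p.ns
  {b | (nd = nc ∧ b = max nd (min nr ns)) ∨
    b = max (max nd nc) nr + max nd nc ∨
    b = nr + 2 * max nd nc - nc ∨
    b = max nd nc + max nd ns ∨
    b = 2 * max (max nc nr) (nd - max nc ns) + 2 * max (ns - nc) 0 ∨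
    (nr ≤ nc ∧ nc ≤ nd ∧ b = 2 * max nc (nr + nd - nc)) ∨
    b = 2 * max nd nr ∨
    b = max (max nd nr) nc + max nd nc - nc + max (ns - max nd nc) 0}

/-- The sum-capacity expression for `nc < ns` and `nc ≠ nd`. -/
def sumCapacityExpr (p : LDIRC) : ℤ :=
  let nd : ℤ := p.nd
  let nc : ℤ := p.nc
  let nr : ℤ := p.nr
  let ns : ℤ := p.ns
  min (min (min (2 * max nd nr)
      (max (max nd nc) nr + max nd nc - max (nc - max (ns - max nd nc) 0) 0))
      (min (nr + 2 * max nd nc - nc) (2 * max (max ns (nr + ns - nc)) (nd - nc))))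
    (min (max nd nc + max nd ns) (2 * max nc (nr + max (nd - nc) 0)))

end LDIRC

/-! ### Links as shifts of bit levels -/

namespace LDIRC

/-! Optimality is a counting argument. The message pairs that both receivers decode correctly inject
into a set of bit strings. If the other user's message is given, a receiver sees only `max nd nr`
levels (`card_correct_le_single`, used once per user). Three further injections let one decode the
first message and then, since the cross link is the stronger one, reproduce the other receiver's
output. The side information is the relay's observation, the relay's contribution at the receivers,
or the levels of the second user that only the relay hears (`card_correct_le_relayOutput`,
`card_correct_le_relayInput`, `card_correct_le_hidden`). Once the error probability is below 1/2, at
least half of all message pairs are counted, so each exponent bounds the rates. The four bounds are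
the four terms of `siSumRate`.

Achievability rests on backward decoding (`KnownAt.pred`, `eq_of_rxSignal_eq`). From the later
blocks a receiver knows, for block `k`, both users' decode-forward bits, the sums of the
compute-forward bits, and its own neutralization bits. It scans the levels of the cross link
downwards. The direct copy of its own signal is delayed by `E > 0` levels, so it is already known.
What remains is the undesired user's bit plus the relay's bit. Common bits are resolved by a joint
code, and a compute-forward bit of the other user gives the desired one through the known sum. On
the lowest levels the relay cancels the interference and leaves the desired `cn` bit of block `k -
1`. Subtracting both users' signals exposes the upper part of the relay signal, which supplies the
remaining knowledge about block `k - 1`.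

The relay can act causally because all it needs is contained in the sums of earlier blocks
(`relaySignal_eq_of_sum_eq`). It remains to choose lengths that attain the sum-rate, regime by
regime (`exists_optimal`), and to pass from block codes to the capacity region
(`mem_capacityRegion_of_codes`). -/

theorem shiftMatrix_pow_mulVec (q s : ℕ) (x : Fin q → ZMod 2) (i : Fin q) :
    (shiftMatrix q ^ s).mulVec x i =
      if s ≤ i.val then x ⟨i.val - s, (Nat.sub_le _ _).trans_lt i.isLt⟩ else 0 := by
  induction s generalizing i with
  | zero => simp
  | succ s ih =>
    rw [pow_succ', ← Matrix.mulVec_mulVec]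
    simp only [Matrix.mulVec, dotProduct, shiftMatrix, Matrix.of_apply] at ih ⊢
    by_cases hi : i.val = 0
    · rw [if_neg (by omega)]
      refine Finset.sum_eq_zero fun j _ => ?_
      rw [if_neg (by omega), zero_mul]
    · rw [Finset.sum_eq_single (⟨i.val - 1, by omega⟩ : Fin q)]
      · rw [if_pos (by simp only; omega), one_mul, ih]
        by_cases h : s + 1 ≤ i.val
        · rw [if_pos (by simp only; omega), if_pos h]
          congr 2
          simp only
          omega
        · rw [if_neg (by simp only; omega), if_neg h]
      · intro j _ hj
        rw [if_neg, zero_mul]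
        intro h
        exact hj (Fin.ext (by simp only; omega))
      · simp

variable {p : LDIRC}

theorem link_apply (m : ℕ) (x : p.Vec) (i : Fin p.q) :
    p.link m x i =
      if p.q - m ≤ i.val then x ⟨i.val - (p.q - m), (Nat.sub_le _ _).trans_lt i.isLt⟩ else 0 :=
  shiftMatrix_pow_mulVec _ _ _ _

theorem nd_le_q : p.nd ≤ p.q := by simp [q]
theorem nc_le_q : p.nc ≤ p.q := by simp [q]
theorem nr_le_q : p.nr ≤ p.q := by simp [q]
theorem ns_le_q : p.ns ≤ p.q := by simp [q]

/-- A vector whose levels above the bottom `m` ones vanish. -/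
def SupportedBelow (m : ℕ) (y : p.Vec) : Prop := ∀ i : Fin p.q, i.val < p.q - m → y i = 0

theorem supportedBelow_link {m m' : ℕ} (h : m ≤ m') (x : p.Vec) :
    SupportedBelow m' (p.link m x) := by
  intro i hi
  rw [link_apply, if_neg (by omega)]

theorem SupportedBelow.add {m : ℕ} {y z : p.Vec} (hy : SupportedBelow m y)
    (hz : SupportedBelow m z) : SupportedBelow m (y + z) := by
  intro i hi
  rw [Pi.add_apply, hy i hi, hz i hi, add_zero]

/-- The bottom `m` levels of a vector. -/
def bottom (m : ℕ) (y : p.Vec) (j : Fin m) : ZMod 2 :=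
  if h : p.q - m + j.val < p.q then y ⟨p.q - m + j.val, h⟩ else 0

theorem eq_of_bottom_eq {m : ℕ} {y z : p.Vec} {i : Fin p.q} (hi : p.q - m ≤ i.val)
    (hm : m ≤ p.q) (h : bottom m y = bottom m z) : y i = z i := by
  have := congrFun h ⟨i.val - (p.q - m), by omega⟩
  simp only [bottom] at this
  have e : p.q - m + (i.val - (p.q - m)) = i.val := by omega
  rw [dif_pos (by omega), dif_pos (by omega)] at this
  convert this using 2 <;> exact Fin.ext e.symm

theorem SupportedBelow.eq_of_bottom_eq {m : ℕ} (hm : m ≤ p.q) {y z : p.Vec}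
    (hy : SupportedBelow m y) (hz : SupportedBelow m z) (h : bottom m y = bottom m z) :
    y = z := by
  funext i
  by_cases hi : i.val < p.q - m
  · rw [hy i hi, hz i hi]
  · exact LDIRC.eq_of_bottom_eq (by omega) hm h

theorem link_eq_of_le {m m' : ℕ} (hm : m ≤ m') (hq : m' ≤ p.q) {x x' : p.Vec}
    (h : p.link m' x = p.link m' x') : p.link m x = p.link m x' := by
  funext i
  rw [link_apply, link_apply]
  split_ifs with hi
  · have := congrFun h ⟨i.val - (p.q - m) + (p.q - m'), by omega⟩
    rw [link_apply, link_apply, if_pos (by simp only; omega), if_pos (by simp only; omega)] at this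
    simpa using this
  · rfl

/-- The top `m'` levels consist of the top `m` levels and the `m' - m` levels below them. -/
theorem link_eq_of_bottom_eq {m m' : ℕ} (hm : m ≤ m') (hq : m' ≤ p.q) {x x' : p.Vec}
    (h : p.link m x = p.link m x')
    (hb : bottom (m' - m) (p.link m' x) = bottom (m' - m) (p.link m' x')) :
    p.link m' x = p.link m' x' := by
  funext i
  by_cases hi : p.q - (m' - m) ≤ i.val
  · exact eq_of_bottom_eq hi (by omega) hb
  · rw [link_apply, link_apply]
    split_ifs with hi'
    · have := congrFun h ⟨i.val - (p.q - m') + (p.q - m), by omega⟩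
      rw [link_apply, link_apply, if_pos (by simp only; omega),
        if_pos (by simp only; omega)] at this
      simpa using this
    · rfl

/-! ### Genie bounds on the number of correctly decoded message pairs -/

namespace Code

variable {n : ℕ} {M : Fin 2 → ℕ} (C : Code p n M)

/-- Both receivers decode correctly. -/
def Correct (w : (i : Fin 2) → Fin (M i)) : Prop := ∀ j, C.dec j (C.output j w) = w j

variable {C}

theorem Correct.eq_of_output_eq {w w' : (i : Fin 2) → Fin (M i)} (h : C.Correct w)
    (h' : C.Correct w') {j : Fin 2} (e : C.output j w = C.output j w') : w j = w' j := by
  rw [← h j, ← h' j, e]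

theorem relayInput_eq {w w' : (i : Fin 2) → Fin (M i)} {k : Fin n}
    (h : ∀ l : Fin n, l < k → C.relayOutput w l = C.relayOutput w' l) :
    C.relayInput w k = C.relayInput w' k := by
  unfold relayInput
  congr 1
  funext l
  exact h _ (Fin.lt_def.2 l.isLt)

/-- The signal at receiver `j` without the contribution of the relay. -/
def directOutput (C : Code p n M) (j : Fin 2) (w : (i : Fin 2) → Fin (M i)) (k : Fin n) : p.Vec :=
  p.link p.nd (C.enc j (w j) k) + p.link p.nc (C.enc (1 - j) (w (1 - j)) k)

theorem output_eq (j : Fin 2) (w : (i : Fin 2) → Fin (M i)) (k : Fin n) :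
    C.output j w k = C.directOutput j w k + p.link p.nr (C.relayInput w k) := rfl

theorem funext_fin2 {w w' : (i : Fin 2) → Fin (M i)} (h0 : w 0 = w' 0) (h1 : w 1 = w' 1) :
    w = w' := by
  funext i
  fin_cases i
  · exact h0
  · exact h1

theorem output_one (w : (i : Fin 2) → Fin (M i)) (k : Fin n) :
    C.output 1 w k = p.link p.nd (C.enc 1 (w 1) k) + p.link p.nc (C.enc 0 (w 0) k)
      + p.link p.nr (C.relayInput w k) := rfl

theorem directOutput_zero (w : (i : Fin 2) → Fin (M i)) (k : Fin n) :
    C.directOutput 0 w k = p.link p.nd (C.enc 0 (w 0) k) + p.link p.nc (C.enc 1 (w 1) k) := rfl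

theorem card_bits (n m : ℕ) : Nat.card (Fin n → Fin m → ZMod 2) = 2 ^ (n * m) := by
  simp [Nat.card_eq_fintype_card, ← pow_mul, mul_comm]

theorem card_bits_prod (n m m' : ℕ) :
    Nat.card ((Fin n → Fin m → ZMod 2) × (Fin n → Fin m' → ZMod 2)) = 2 ^ (n * (m + m')) := by
  rw [Nat.card_prod, card_bits, card_bits, ← pow_add, ← mul_add]

/-- The rate of a user is at most the number of levels through which its receiver is reached by
its transmitter and the relay. -/
theorem card_correct_le_single (C : Code p n M) (j : Fin 2) :
    Nat.card {w // C.Correct w} ≤ M (1 - j) * 2 ^ (n * max p.nd p.nr) := by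
  let F : {w // C.Correct w} → Fin (M (1 - j)) × (Fin n → Fin (max p.nd p.nr) → ZMod 2) :=
    fun w => (w.1 (1 - j), fun k => bottom _ (p.link p.nd (C.enc j (w.1 j) k)
      + p.link p.nr (C.relayInput w.1 k)))
  have hF : Function.Injective F := by
    rintro ⟨w, hw⟩ ⟨w', hw'⟩ e
    obtain ⟨e1, e2⟩ := Prod.ext_iff.1 e
    simp only [F] at e1 e2
    have hj : w j = w' j := by
      refine hw.eq_of_output_eq hw' (funext fun k => ?_)
      have := SupportedBelow.eq_of_bottom_eq (max_le nd_le_q nr_le_q)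
        ((supportedBelow_link (le_max_left _ _) _).add (supportedBelow_link (le_max_right _ _) _))
        ((supportedBelow_link (le_max_left _ _) _).add (supportedBelow_link (le_max_right _ _) _))
        (congrFun e2 k)
      rw [output_eq, output_eq, directOutput, directOutput, add_right_comm, this, e1,
        add_right_comm]
    refine Subtype.ext (funext fun i => ?_)
    by_cases hi : i = j
    · rw [hi]; exact hj
    · have : i = 1 - j := by omega
      rw [this]; exact e1
  have := Nat.card_le_card_of_injective F hF
  rwa [Nat.card_prod, card_bits, Nat.card_fin] at this

/-- A receiver that knows the output of the relay can decode both messages. -/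
theorem card_correct_le_relayOutput (C : Code p n M) (hdc : p.nd ≤ p.nc) (hcs : p.nc ≤ p.ns) :
    Nat.card {w // C.Correct w} ≤ 2 ^ (n * (p.ns + p.nc)) := by
  let F : {w // C.Correct w} → (Fin n → Fin p.ns → ZMod 2) × (Fin n → Fin p.nc → ZMod 2) :=
    fun w => (fun k => bottom _ (C.relayOutput w.1 k), fun k => bottom _ (C.directOutput 0 w.1 k))
  have hF : Function.Injective F := by
    rintro ⟨w, hw⟩ ⟨w', hw'⟩ e
    obtain ⟨e1, e2⟩ := Prod.ext_iff.1 e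
    have hr : ∀ k, C.relayOutput w k = C.relayOutput w' k := fun k =>
      SupportedBelow.eq_of_bottom_eq ns_le_q
        ((supportedBelow_link le_rfl _).add (supportedBelow_link le_rfl _))
        ((supportedBelow_link le_rfl _).add (supportedBelow_link le_rfl _)) (congrFun e1 k)
    have hd : ∀ k, C.directOutput 0 w k = C.directOutput 0 w' k := fun k =>
      SupportedBelow.eq_of_bottom_eq nc_le_q
        ((supportedBelow_link hdc _).add (supportedBelow_link le_rfl _))
        ((supportedBelow_link hdc _).add (supportedBelow_link le_rfl _)) (congrFun e2 k)
    have hx : ∀ k, C.relayInput w k = C.relayInput w' k := fun k => relayInput_eq fun l _ => hr l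
    have h0 : w 0 = w' 0 := hw.eq_of_output_eq hw' (funext fun k => by
      rw [output_eq, output_eq, hd, hx])
    refine Subtype.ext (funext_fin2 h0 (hw.eq_of_output_eq hw' (funext fun k => ?_)))
    have hs := hr k
    rw [relayOutput, relayOutput, h0] at hs
    -- Since `nd ≤ ns`, the levels that reach the second receiver directly are among those heard by
    -- the relay.
    rw [output_one, output_one, h0, hx,
      link_eq_of_le (hdc.trans hcs) ns_le_q (add_left_cancel hs)]
  exact (Nat.card_le_card_of_injective F hF).trans_eq (card_bits_prod _ _ _)

/-- A receiver that knows what it receives from the relay can decode both messages. -/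
theorem card_correct_le_relayInput (C : Code p n M) (hdc : p.nd ≤ p.nc) :
    Nat.card {w // C.Correct w} ≤ 2 ^ (n * (p.nc + p.nr)) := by
  let F : {w // C.Correct w} → (Fin n → Fin p.nc → ZMod 2) × (Fin n → Fin p.nr → ZMod 2) :=
    fun w => (fun k => bottom _ (C.directOutput 0 w.1 k),
      fun k => bottom _ (p.link p.nr (C.relayInput w.1 k)))
  have hF : Function.Injective F := by
    rintro ⟨w, hw⟩ ⟨w', hw'⟩ e
    obtain ⟨e1, e2⟩ := Prod.ext_iff.1 e
    have hd : ∀ k, C.directOutput 0 w k = C.directOutput 0 w' k := fun k =>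
      SupportedBelow.eq_of_bottom_eq nc_le_q
        ((supportedBelow_link hdc _).add (supportedBelow_link le_rfl _))
        ((supportedBelow_link hdc _).add (supportedBelow_link le_rfl _)) (congrFun e1 k)
    have hx : ∀ k, p.link p.nr (C.relayInput w k) = p.link p.nr (C.relayInput w' k) := fun k =>
      SupportedBelow.eq_of_bottom_eq nr_le_q
        (supportedBelow_link le_rfl _) (supportedBelow_link le_rfl _) (congrFun e2 k)
    have h0 : w 0 = w' 0 := hw.eq_of_output_eq hw' (funext fun k => by
      rw [output_eq, output_eq, hd, hx])
    refine Subtype.ext (funext_fin2 h0 (hw.eq_of_output_eq hw' (funext fun k => ?_)))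
    have hc := hd k
    rw [directOutput_zero, directOutput_zero, h0] at hc
    rw [output_one, output_one, h0, hx, link_eq_of_le hdc nc_le_q (add_left_cancel hc)]
  exact (Nat.card_le_card_of_injective F hF).trans_eq (card_bits_prod _ _ _)

/-- A receiver that knows the levels of the undesired transmitter which only the relay hears can
decode both messages. -/
theorem card_correct_le_hidden (C : Code p n M) (hdc : p.nd ≤ p.nc) (hcs : p.nc ≤ p.ns) :
    Nat.card {w // C.Correct w} ≤ 2 ^ (n * (max p.nr p.nc + (p.ns - p.nc))) := by
  let F : {w // C.Correct w} →
      (Fin n → Fin (max p.nr p.nc) → ZMod 2) × (Fin n → Fin (p.ns - p.nc) → ZMod 2) :=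
    fun w => (fun k => bottom _ (C.output 0 w.1 k),
      fun k => bottom _ (p.link p.ns (C.enc 1 (w.1 1) k)))
  have hF : Function.Injective F := by
    rintro ⟨w, hw⟩ ⟨w', hw'⟩ e
    obtain ⟨e1, e2⟩ := Prod.ext_iff.1 e
    have supp : ∀ (v : (i : Fin 2) → Fin (M i)) (k : Fin n),
        SupportedBelow (max p.nr p.nc) (C.output 0 v k) := fun v k =>
      ((supportedBelow_link (hdc.trans (le_max_right _ _)) _).add
        (supportedBelow_link (le_max_right _ _) _)).add (supportedBelow_link (le_max_left _ _) _)
    have ho : ∀ k, C.output 0 w k = C.output 0 w' k := fun k =>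
      SupportedBelow.eq_of_bottom_eq (max_le nr_le_q nc_le_q) (supp w k) (supp w' k)
        (congrFun e1 k)
    have h0 : w 0 = w' 0 := hw.eq_of_output_eq hw' (funext ho)
    -- Induction on time: the past relay outputs determine the current relay input. Subtracting it
    -- from the first receiver's output leaves the top `nc` levels of the second user, and the
    -- hidden levels complete them to the `ns` levels that the relay hears.
    have key : ∀ (t : ℕ) (k : Fin n), k.val = t → C.relayInput w k = C.relayInput w' k ∧
        p.link p.ns (C.enc 1 (w 1) k) = p.link p.ns (C.enc 1 (w' 1) k) := by
      intro t
      induction t using Nat.strong_induction_on with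
      | _ t ih =>
        intro k hk
        have hx : C.relayInput w k = C.relayInput w' k := relayInput_eq fun l hl => by
          rw [relayOutput, relayOutput, h0, (ih l.val (by rw [← hk]; exact hl) l rfl).2]
        refine ⟨hx, link_eq_of_bottom_eq hcs ns_le_q ?_ (congrFun e2 k)⟩
        have := ho k
        rw [output_eq, output_eq, hx, directOutput_zero, directOutput_zero, h0] at this
        exact add_left_cancel (add_right_cancel this)
    refine Subtype.ext (funext_fin2 h0 (hw.eq_of_output_eq hw' (funext fun k => ?_)))
    obtain ⟨hx, hs⟩ := key k k rfl
    rw [output_one, output_one, h0, hx, link_eq_of_le (hdc.trans hcs) ns_le_q hs]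
  exact (Nat.card_le_card_of_injective F hF).trans_eq (card_bits_prod _ _ _)

end Code

/-! ### From message counts to rates -/

namespace Code

/-- The messages are uniform, so the error probability is a proportion of pairs. This bound makes
counting a substitute for entropy inequalities. -/
theorem mul_le_two_mul_card_correct {n : ℕ} {M : Fin 2 → ℕ} (C : Code p n M)
    (h : C.errorProb < 1 / 2) : M 0 * M 1 ≤ 2 * Nat.card {w // C.Correct w} := by
  classical
  have hsum : Nat.card {w : (i : Fin 2) → Fin (M i) // ∃ j, C.dec j (C.output j w) ≠ w j}
      + Nat.card {w // C.Correct w} = M 0 * M 1 := by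
    have h1 : Nat.card ((i : Fin 2) → Fin (M i)) = M 0 * M 1 := by
      simp [Nat.card_eq_fintype_card]
    have h2 := Fintype.card_subtype_compl (fun w : (i : Fin 2) → Fin (M i) => C.Correct w)
    have h3 := Fintype.card_subtype_le (fun w : (i : Fin 2) → Fin (M i) => C.Correct w)
    have h4 : Nat.card {w : (i : Fin 2) → Fin (M i) // ∃ j, C.dec j (C.output j w) ≠ w j}
        = Nat.card {w // ¬ C.Correct w} :=
      Nat.card_congr (Equiv.subtypeEquivRight fun w => by simp only [Correct, not_forall, ne_eq])
    rw [h4, ← h1]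
    simp only [Nat.card_eq_fintype_card] at *
    omega
  rcases Nat.eq_zero_or_pos (M 0 * M 1) with h0 | h0
  · rw [h0]; exact Nat.zero_le _
  · unfold errorProb at h
    have hpos : (0 : ℝ) < (M 0 : ℝ) * M 1 := by exact_mod_cast h0
    rw [div_lt_iff₀ hpos] at h
    have hsum' : (Nat.card {w : (i : Fin 2) → Fin (M i) // ∃ j, C.dec j (C.output j w) ≠ w j} : ℝ)
      + Nat.card {w // C.Correct w} = (M 0 : ℝ) * M 1 := by exact_mod_cast hsum
    have : (M 0 : ℝ) * M 1 ≤ 2 * Nat.card {w // C.Correct w} := by linarith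
    exact_mod_cast this

end Code

/-- If `a > b`, then `2 ^ (n * (a - b))` outgrows every constant `K`. -/
theorem le_of_eventually_two_rpow_le {a b K : ℝ}
    (h : ∀ᶠ n : ℕ in atTop, (2 : ℝ) ^ ((n : ℝ) * a) ≤ K * 2 ^ ((n : ℝ) * b)) : a ≤ b := by
  by_contra! hab
  have ht : Tendsto (fun n : ℕ => ((2 : ℝ) ^ (a - b)) ^ n) atTop atTop :=
    tendsto_pow_atTop_atTop_of_one_lt (Real.one_lt_rpow one_lt_two (sub_pos.2 hab))
  obtain ⟨n, hn, hn'⟩ := (h.and (ht.eventually_gt_atTop K)).exists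
  rw [← Real.rpow_natCast, ← Real.rpow_mul zero_le_two] at hn'
  have : (2 : ℝ) ^ ((n : ℝ) * a) = 2 ^ ((a - b) * n) * 2 ^ ((n : ℝ) * b) := by
    rw [← Real.rpow_add two_pos]; congr 1; ring
  rw [this] at hn
  exact absurd (le_of_mul_le_mul_right hn (Real.rpow_pos_of_pos two_pos _)) (not_le.2 hn')

theorem half_le_natFloor {x : ℝ} (hx : 1 ≤ x) : x / 2 ≤ ⌊x⌋₊ := by
  have h1 : (1 : ℝ) ≤ ⌊x⌋₊ := by exact_mod_cast Nat.le_floor (by simpa using hx)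
  have h2 := Nat.lt_floor_add_one x
  linarith

theorem one_le_two_rpow_mul {R : ℝ} (hR : 0 ≤ R) (n : ℕ) : (1 : ℝ) ≤ 2 ^ ((n : ℝ) * R) :=
  Real.one_le_rpow one_le_two (mul_nonneg n.cast_nonneg hR)

theorem two_rpow_mul_natCast (n b : ℕ) : (2 : ℝ) ^ ((n : ℝ) * (b : ℝ)) = 2 ^ (n * b) := by
  rw [← Nat.cast_mul, Real.rpow_natCast]

namespace Achievable

variable {R : Fin 2 → ℝ}

theorem eventually_card_correct (h : p.Achievable R) :
    ∃ C : (n : ℕ) → Code p n fun i => ⌊(2 : ℝ) ^ ((n : ℝ) * R i)⌋₊,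
      ∀ᶠ n : ℕ in atTop, ⌊(2 : ℝ) ^ ((n : ℝ) * R 0)⌋₊ * ⌊(2 : ℝ) ^ ((n : ℝ) * R 1)⌋₊ ≤
        2 * Nat.card {w // (C n).Correct w} := by
  obtain ⟨-, C, hC⟩ := h
  exact ⟨C, (hC.eventually (gt_mem_nhds (by norm_num : (0 : ℝ) < 1 / 2))).mono
    fun n hn => (C n).mul_le_two_mul_card_correct hn⟩

theorem sum_le (h : p.Achievable R) {b : ℕ}
    (hb : ∀ (n : ℕ) (M : Fin 2 → ℕ) (C : Code p n M),
      Nat.card {w // C.Correct w} ≤ 2 ^ (n * b)) : R 0 + R 1 ≤ b := by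
  obtain ⟨C, hC⟩ := h.eventually_card_correct
  -- A factor 2 comes from the erroneous pairs, and a factor 2 from each of the two floors.
  refine le_of_eventually_two_rpow_le (K := 8) (hC.mono fun n hn => ?_)
  have h1 : ((⌊(2 : ℝ) ^ ((n : ℝ) * R 0)⌋₊ : ℝ) * ⌊(2 : ℝ) ^ ((n : ℝ) * R 1)⌋₊) ≤
      2 * 2 ^ (n * b) := by
    exact_mod_cast hn.trans (Nat.mul_le_mul_left 2 (hb n _ (C n)))
  have h2 := half_le_natFloor (one_le_two_rpow_mul (h.1 0) n)
  have h3 := half_le_natFloor (one_le_two_rpow_mul (h.1 1) n)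
  have h4 := mul_le_mul h2 h3 (by positivity) (by positivity)
  rw [mul_add, Real.rpow_add two_pos, two_rpow_mul_natCast]
  linarith

theorem le_single (h : p.Achievable R) (j : Fin 2) : R j ≤ (max p.nd p.nr : ℕ) := by
  obtain ⟨C, hC⟩ := h.eventually_card_correct
  -- The other user's message count cancels, so only one floor is lost.
  refine le_of_eventually_two_rpow_le (K := 4) (hC.mono fun n hn => ?_)
  have hpos : 0 < ⌊(2 : ℝ) ^ ((n : ℝ) * R (1 - j))⌋₊ :=
    Nat.floor_pos.2 (one_le_two_rpow_mul (h.1 _) n)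
  have hprod : ⌊(2 : ℝ) ^ ((n : ℝ) * R 0)⌋₊ * ⌊(2 : ℝ) ^ ((n : ℝ) * R 1)⌋₊ =
      ⌊(2 : ℝ) ^ ((n : ℝ) * R (1 - j))⌋₊ * ⌊(2 : ℝ) ^ ((n : ℝ) * R j)⌋₊ := by
    fin_cases j
    · exact mul_comm _ _
    · rfl
  have h1 : ⌊(2 : ℝ) ^ ((n : ℝ) * R j)⌋₊ ≤ 2 * 2 ^ (n * max p.nd p.nr) := by
    refine Nat.le_of_mul_le_mul_left ?_ hpos
    rw [← hprod]
    refine hn.trans ((Nat.mul_le_mul_left 2 ((C n).card_correct_le_single j)).trans_eq ?_)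
    ring
  have h2 := half_le_natFloor (one_le_two_rpow_mul (h.1 j) n)
  have h3 : (⌊(2 : ℝ) ^ ((n : ℝ) * R j)⌋₊ : ℝ) ≤ 2 * 2 ^ (n * max p.nd p.nr) := by
    exact_mod_cast h1
  rw [two_rpow_mul_natCast]
  linarith

theorem sum_le_siSumRate (h : p.Achievable R) (hdc : p.nd ≤ p.nc) (hcs : p.nc ≤ p.ns) :
    R 0 + R 1 ≤ p.siSumRate := by
  have h1 := h.le_single 0
  have h2 := h.le_single 1
  have h3 := h.sum_le fun n M C => C.card_correct_le_hidden hdc hcs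
  have h4 := h.sum_le fun n M C => C.card_correct_le_relayOutput hdc hcs
  have h5 := h.sum_le fun n M C => C.card_correct_le_relayInput hdc
  push_cast [Nat.cast_sub hcs] at h1 h2 h3 h4 h5
  unfold siSumRate
  push_cast
  exact le_min (le_min (by linarith) h3) (le_min h4 h5)

end Achievable

theorem sum_le_of_mem_capacityRegion (hdc : p.nd ≤ p.nc) (hcs : p.nc ≤ p.ns) {R : Fin 2 → ℝ}
    (h : R ∈ p.capacityRegion) : R 0 + R 1 ≤ p.siSumRate := by
  have hcl : IsClosed {R : Fin 2 → ℝ | R 0 + R 1 ≤ p.siSumRate} :=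
    isClosed_le (by fun_prop) continuous_const
  exact closure_minimal (fun R hR => Achievable.sum_le_siSumRate hR hdc hcs) hcl h

/-! ### Comparison of the rate expressions -/

/-- For `nd < nc < ns`, four of the bounds reduce to the four terms of the minimum. Two others
dominate one of these terms, and the bounds that require `nd = nc` or `nc ≤ nd` do not apply. -/
theorem siSumRate_isLeast (hSI : p.nd < p.nc) (hs : p.nc < p.ns) :
    IsLeast p.upperBoundExprs p.siSumRate := by
  have h1 : (p.nd : ℤ) < p.nc := by exact_mod_cast hSI
  have h2 : (p.nc : ℤ) < p.ns := by exact_mod_cast hs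
  simp only [upperBoundExprs, siSumRate, max_eq_right h1.le, max_eq_right (h1.trans h2).le,
    max_eq_left (sub_nonneg.2 h2.le), max_eq_right h2.le]
  rw [max_right_comm (p.nd : ℤ), max_eq_right h1.le, max_comm (p.nc : ℤ) p.nr]
  constructor
  · rw [Set.mem_ofPred_eq]
    rcases min_choice (min (2 * max (p.nd : ℤ) p.nr) (max (p.nr : ℤ) p.nc + (p.ns - p.nc)))
      (min ((p.ns : ℤ) + p.nc) ((p.nc : ℤ) + p.nr)) with h | h <;> rw [h]
    · rcases min_choice (2 * max (p.nd : ℤ) p.nr) (max (p.nr : ℤ) p.nc + (p.ns - p.nc))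
        with h | h <;> rw [h] <;> omega
    · rcases min_choice ((p.ns : ℤ) + p.nc) ((p.nc : ℤ) + p.nr) with h | h <;> rw [h] <;> omega
  · rintro b (hb | hb | hb | hb | hb | hb | hb | hb) <;> omega

/-- The second term of the expression becomes `max nr nc + min nc (ns - nc)`. It differs from the
term of `siSumRate` only when `nc ≤ ns - nc`, and then both are at least `nc + nr`. The additional
terms are never the smallest. -/
theorem siSumRate_eq_sumCapacityExpr (hSI : p.nd < p.nc) (hs : p.nc < p.ns) :
    p.siSumRate = p.sumCapacityExpr := by
  have h1 : (p.nd : ℤ) < p.nc := by exact_mod_cast hSI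
  have h2 : (p.nc : ℤ) < p.ns := by exact_mod_cast hs
  simp only [sumCapacityExpr, siSumRate, max_eq_right h1.le, max_eq_right (h1.trans h2).le,
    max_eq_left (sub_nonneg.2 h2.le), max_eq_right (sub_nonpos.2 h1.le), add_zero]
  rw [max_eq_left (b := (p.nd : ℤ) - p.nc) (le_max_of_le_left (by omega))]
  generalize max (p.nd : ℤ) p.nr = m
  rcases le_total (p.nr : ℤ) p.nc with h3 | h3
  · rw [max_eq_left (a := (p.ns : ℤ)) (by omega), max_eq_left h3, max_eq_right h3]
    rcases le_total ((p.nc : ℤ) - (p.ns - p.nc)) 0 with h4 | h4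
    · rw [max_eq_right h4]; omega
    · rw [max_eq_left h4]; omega
  · rw [max_eq_right (a := (p.ns : ℤ)) (by omega), max_eq_right h3, max_eq_left h3]
    rcases le_total ((p.nc : ℤ) - (p.ns - p.nc)) 0 with h4 | h4
    · rw [max_eq_right h4]; omega
    · rw [max_eq_left h4]; omega

/-! ### Codes for the common signals -/

/-- With this encoder the messages of both users can be recovered from the sum of one codeword and
the other codeword shifted down by `E` levels. -/
def JointlyDecodable {m l : ℕ} (E : ℕ) (enc : (Fin m → ZMod 2) → Fin l → ZMod 2) : Prop :=
  ∀ u v u' v' : Fin m → ZMod 2,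
    (∀ i : Fin l, enc u i + (if E ≤ i.val then
        enc v ⟨i.val - E, (Nat.sub_le _ _).trans_lt i.isLt⟩ else 0) =
      enc u' i + (if E ≤ i.val then
        enc v' ⟨i.val - E, (Nat.sub_le _ _).trans_lt i.isLt⟩ else 0)) → u = u' ∧ v = v'

/-- Without encoding, the codewords do not overlap if the shift is large. -/
theorem exists_jointlyDecodable_of_le_shift {m l E : ℕ} (hE : m ≤ E) (hl : E + m ≤ l) :
    ∃ enc : (Fin m → ZMod 2) → Fin l → ZMod 2, JointlyDecodable E enc := by
  refine ⟨fun u i => if h : i.val < m then u ⟨i, h⟩ else 0, fun u v u' v' H => ⟨?_, ?_⟩⟩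
  · funext j
    have := H ⟨j, by omega⟩
    have hj : ¬ E ≤ j.val := by omega
    simpa [hj] using this
  · funext j
    have := H ⟨E + j, by omega⟩
    have hj : ¬ E + j.val < m := by omega
    simpa [hj] using this

/-- Encoding of `k * E + r` bits into twice as many levels: `k` blocks of length `E` alternate with
zeros, and the remaining `r` bits are sent twice, over the last zeros and at the bottom. -/
def alternatingCode (E k r : ℕ) (x : ℕ → ZMod 2) (i : ℕ) : ZMod 2 :=
  if i / (2 * E) < k then
    if i % (2 * E) < E then x (i / (2 * E) * E + i % (2 * E))
    else if i / (2 * E) + 1 = k ∧ i % (2 * E) < E + r then x (k * E + (i % (2 * E) - E))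
    else 0
  else if i < k * (2 * E) + r then 0
  else x (k * E + (i - (k * (2 * E) + r)))

section alternatingCode

variable {E k r : ℕ} (x : ℕ → ZMod 2)

theorem alternatingCode_even {i o : ℕ} (hi : i < k) (ho : o < E) :
    alternatingCode E k r x (2 * E * i + o) = x (i * E + o) := by
  have h1 : (2 * E * i + o) / (2 * E) = i := by
    rw [Nat.mul_add_div (by omega), Nat.div_eq_of_lt (by omega), add_zero]
  have h2 : (2 * E * i + o) % (2 * E) = o := by
    rw [Nat.mul_add_mod, Nat.mod_eq_of_lt (by omega)]
  rw [alternatingCode, h1, h2, if_pos hi, if_pos ho]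

theorem alternatingCode_odd {i o : ℕ} (hi : i < k) (ho : o < E) :
    alternatingCode E k r x (2 * E * i + (E + o)) =
      if i + 1 = k ∧ o < r then x (k * E + o) else 0 := by
  have h1 : (2 * E * i + (E + o)) / (2 * E) = i := by
    rw [Nat.mul_add_div (by omega), Nat.div_eq_of_lt (by omega), add_zero]
  have h2 : (2 * E * i + (E + o)) % (2 * E) = E + o := by
    rw [Nat.mul_add_mod, Nat.mod_eq_of_lt (by omega)]
  rw [alternatingCode, h1, h2, if_pos hi, if_neg (by omega)]
  simp

theorem alternatingCode_bottom {o : ℕ} (hE : 0 < E) :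
    alternatingCode E k r x (2 * E * k + o) = if o < r then 0 else x (k * E + (o - r)) := by
  have h1 : ¬ (2 * E * k + o) / (2 * E) < k := by
    rw [Nat.mul_add_div (by omega), not_lt]
    exact Nat.le_add_right _ _
  rw [alternatingCode, if_neg h1, mul_comm k (2 * E)]
  simp only [Nat.add_lt_add_iff_left, Nat.add_sub_add_left]

end alternatingCode

/-- The messages can be recovered from the sum of a codeword and a shifted codeword. -/
theorem alternatingCode_jointlyDecodable {E k r : ℕ} (hk : 0 < k) (hr : r < E)
    {x y x' y' : ℕ → ZMod 2}
    (H : ∀ i < 2 * (k * E + r),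
      alternatingCode E k r x i + (if E ≤ i then alternatingCode E k r y (i - E) else 0) =
      alternatingCode E k r x' i + (if E ≤ i then alternatingCode E k r y' (i - E) else 0)) :
    ∀ i < k * E + r, x i = x' i ∧ y i = y' i := by
  have hE : 0 < E := by omega
  obtain ⟨k, rfl⟩ : ∃ k', k = k' + 1 := ⟨k - 1, by omega⟩
  have e1 : 2 * E * (k + 1) = 2 * E * k + 2 * E := by ring
  have e2 : 2 * ((k + 1) * E + r) = 2 * E * k + 2 * E + 2 * r := by ring
  -- The bottom copy of the tail of `x` meets only zeros of the shifted codeword: either the rest of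
  -- the last gap or the `r` zeros after it.
  have hx : ∀ o < r, x ((k + 1) * E + o) = x' ((k + 1) * E + o) := by
    intro o ho
    have h := H (2 * E * (k + 1) + (r + o)) (by omega)
    have hz : ∀ z, alternatingCode E (k + 1) r z (2 * E * (k + 1) + (r + o) - E) = 0 := by
      intro z
      by_cases hro : r + o < E
      · rw [show 2 * E * (k + 1) + (r + o) - E = 2 * E * k + (E + (r + o)) by omega,
          alternatingCode_odd z (by omega) hro, if_neg (by omega)]
      · rw [show 2 * E * (k + 1) + (r + o) - E = 2 * E * (k + 1) + (r + o - E) by omega,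
          alternatingCode_bottom z hE, if_pos (by omega)]
    rw [hz, hz, alternatingCode_bottom x hE, alternatingCode_bottom x' hE] at h
    simpa using h
  -- Conversely, the copy of the tail of `y` in the last gap is shifted onto the `r` zeros of the
  -- codeword of `x`.
  have hy : ∀ o < r, y ((k + 1) * E + o) = y' ((k + 1) * E + o) := by
    intro o ho
    have h := H (2 * E * (k + 1) + o) (by omega)
    rw [show 2 * E * (k + 1) + o - E = 2 * E * k + (E + o) by omega,
      alternatingCode_odd y (by omega) (by omega), alternatingCode_odd y' (by omega) (by omega),
      alternatingCode_bottom x hE, alternatingCode_bottom x' hE] at h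
    have hle : E ≤ 2 * E * (k + 1) + o := by omega
    simpa [hle, ho] using h
  have hodd : ∀ i < k + 1, ∀ o < E, alternatingCode E (k + 1) r x (2 * E * i + (E + o)) =
      alternatingCode E (k + 1) r x' (2 * E * i + (E + o)) := by
    intro i hi o ho
    rw [alternatingCode_odd x hi ho, alternatingCode_odd x' hi ho]
    split_ifs with h
    · exact hx o h.2
    · rfl
  have hodd' : ∀ i < k, ∀ o < E, ∀ z, alternatingCode E (k + 1) r z (2 * E * i + (E + o)) = 0 := by
    intro i hi o ho z
    rw [alternatingCode_odd z (by omega) ho, if_neg (by omega)]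
  intro i hi
  by_cases hik : i < (k + 1) * E
  · obtain ⟨a, o, ha, ho, rfl⟩ : ∃ a o, a < k + 1 ∧ o < E ∧ i = a * E + o :=
      ⟨i / E, i % E, (Nat.div_lt_iff_lt_mul hE).2 hik, Nat.mod_lt _ hE, (Nat.div_add_mod' i E).symm⟩
    have hle : 2 * E * a ≤ 2 * E * k := Nat.mul_le_mul_left _ (by omega)
    constructor
    -- A data block of `x` meets the preceding gap of `y`, which is not the last gap and hence is
    -- zero.
    · have h := H (2 * E * a + o) (by omega)
      rw [alternatingCode_even x ha ho, alternatingCode_even x' ha ho] at h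
      rcases Nat.eq_zero_or_pos a with rfl | hpos
      · rw [if_neg (by omega), if_neg (by omega)] at h
        simpa using h
      · obtain ⟨b, rfl⟩ : ∃ b, a = b + 1 := ⟨a - 1, by omega⟩
        have e3 : 2 * E * (b + 1) = 2 * E * b + 2 * E := by ring
        rw [show 2 * E * (b + 1) + o - E = 2 * E * b + (E + o) by omega,
          hodd' b (by omega) o ho, hodd' b (by omega) o ho] at h
        simpa using h
    -- A data block of `y` is shifted onto a gap of `x`, whose content is zero or an already decoded
    -- tail.
    · have h := H (2 * E * a + (E + o)) (by omega)
      rw [hodd a ha o ho, if_pos (by omega), if_pos (by omega),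
        show 2 * E * a + (E + o) - E = 2 * E * a + o by omega,
        alternatingCode_even y ha ho, alternatingCode_even y' ha ho] at h
      exact add_left_cancel h
  · obtain ⟨o, rfl⟩ : ∃ o, i = (k + 1) * E + o := ⟨i - (k + 1) * E, by omega⟩
    exact ⟨hx o (by omega), hy o (by omega)⟩

/-- If the shift is small, each user can use half of the levels. -/
theorem exists_jointlyDecodable_of_shift_le {m E : ℕ} (hE : 0 < E) (hm : E ≤ m) :
    ∃ enc : (Fin m → ZMod 2) → Fin (2 * m) → ZMod 2, JointlyDecodable E enc := by
  obtain ⟨k, r, hk, hr, rfl⟩ : ∃ k r, 0 < k ∧ r < E ∧ m = k * E + r :=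
    ⟨m / E, m % E, Nat.div_pos hm hE, Nat.mod_lt _ hE, (Nat.div_add_mod' m E).symm⟩
  refine ⟨fun u i => alternatingCode E k r
    (fun j => if h : j < k * E + r then u ⟨j, h⟩ else 0) i, fun u v u' v' H => ?_⟩
  have := alternatingCode_jointlyDecodable hk hr fun i hi => H ⟨i, hi⟩
  exact ⟨funext fun j => by simpa using (this j j.isLt).1,
    funext fun j => by simpa using (this j j.isLt).2⟩

/-! ### The streams inside the transmitted vectors -/

namespace SIParams

theorem stack_cons_of_lt {l j : ℕ} (u : ℕ → ZMod 2) (t : List (ℕ × (ℕ → ZMod 2))) (h : j < l) :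
    stack ((l, u) :: t) j = u j := if_pos h

theorem stack_cons_add (l j : ℕ) (u : ℕ → ZMod 2) (t : List (ℕ × (ℕ → ZMod 2))) :
    stack ((l, u) :: t) (l + j) = stack t j := by
  simp [stack]

variable (A : SIParams) {B : ℕ}

section signals

variable (i : Fin 2) (m : Fin (B - 1) → A.Payload) (k : ℕ) {j : ℕ}

theorem txSignal_cm1 (h : j < A.lcm1) : A.txSignal i m k j = A.cmSig i m k j :=
  stack_cons_of_lt _ _ h

theorem txSignal_cf1 (h : j < A.rate .cf1) :
    A.txSignal i m k (A.lcm1 + (A.rate .cm2 + j)) = A.sig m .cf1 k j := by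
  simp only [txSignal, stack_cons_add, stack_cons_of_lt _ _ h]

theorem txSignal_pad (h : j < A.l1) :
    A.txSignal i m k (A.lcm1 + (A.rate .cm2 + (A.rate .cf1 + j))) = 0 := by
  simp only [txSignal, stack_cons_add, stack_cons_of_lt _ _ h, Pi.zero_apply]

theorem txSignal_cf2 (h : j < A.rate .cf2) :
    A.txSignal i m k (A.lcm1 + (A.rate .cm2 + (A.rate .cf1 + (A.l1 + j)))) = A.sig m .cf2 k j := by
  simp only [txSignal, stack_cons_add, stack_cons_of_lt _ _ h]

theorem txSignal_txAbove_add :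
    A.txSignal i m k (A.txAbove + j) = stack
      [(A.rate .cn1, A.sig m .cn1 (k - 1) + A.dfSig i m .df1 k),
       (A.rate .cn2, A.sig m .cn2 (k - 1)),
       (2 * A.rate .df2, A.dfSig i m .df2 k),
       (A.rate .cn1, A.sig m .cn1 k),
       (A.rate .cn2, A.sig m .cn2 k)] j := by
  simp only [txAbove, txSignal, add_assoc, stack_cons_add]

theorem txSignal_cn1 (h : j < A.rate .cn1) :
    A.txSignal i m k (A.txAbove + j) = A.sig m .cn1 (k - 1) j + A.dfSig i m .df1 k j := by
  simp only [txSignal_txAbove_add, stack_cons_of_lt _ _ h, Pi.add_apply]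

theorem txSignal_cn2 (h : j < A.rate .cn2) :
    A.txSignal i m k (A.txAbove + (A.rate .cn1 + j)) = A.sig m .cn2 (k - 1) j := by
  simp only [txSignal_txAbove_add, stack_cons_add, stack_cons_of_lt _ _ h]

theorem txSignal_df2 (h : j < 2 * A.rate .df2) :
    A.txSignal i m k (A.txAbove + (A.rate .cn1 + (A.rate .cn2 + j))) = A.dfSig i m .df2 k j := by
  simp only [txSignal_txAbove_add, stack_cons_add, stack_cons_of_lt _ _ h]

theorem txSignal_fresh_cn1 (h : j < A.rate .cn1) :
    A.txSignal i m k (A.txAbove + (A.rate .cn1 + (A.rate .cn2 + (2 * A.rate .df2 + j)))) =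
      A.sig m .cn1 k j := by
  simp only [txSignal_txAbove_add, stack_cons_add, stack_cons_of_lt _ _ h]

theorem txSignal_fresh_cn2 (h : j < A.rate .cn2) :
    A.txSignal i m k
        (A.txAbove + (A.rate .cn1 + (A.rate .cn2 + (2 * A.rate .df2 + (A.rate .cn1 + j))))) =
      A.sig m .cn2 k j := by
  simp only [txSignal_txAbove_add, stack_cons_add, stack_cons_of_lt _ _ h]

end signals

section relay

variable (m : Fin 2 → Fin (B - 1) → A.Payload) (k : ℕ) {j : ℕ}

theorem relaySignal_top (h : j < A.l2) : A.relaySignal m k j = 0 := stack_cons_of_lt _ _ h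

theorem relaySignal_df1 (h : j < 2 * A.rate .df1) :
    A.relaySignal m k (A.l2 + j) =
      A.dfSig 0 (m 0) .df1 (k - 1) j + A.dfSig 1 (m 1) .df1 (k - 1) j := by
  simp only [relaySignal, stack_cons_add, stack_cons_of_lt _ _ h, Pi.add_apply]

theorem relaySignal_df2 (h : j < 2 * A.rate .df2) :
    A.relaySignal m k (A.l2 + (2 * A.rate .df1 + j)) =
      A.dfSig 0 (m 0) .df2 (k - 1) j + A.dfSig 1 (m 1) .df2 (k - 1) j := by
  simp only [relaySignal, stack_cons_add, stack_cons_of_lt _ _ h, Pi.add_apply]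

theorem relaySignal_cf1 (h : j < A.rate .cf1) :
    A.relaySignal m k (A.l2 + (2 * A.rate .df1 + (2 * A.rate .df2 + j))) =
      A.sig (m 0) .cf1 (k - 1) j + A.sig (m 1) .cf1 (k - 1) j := by
  simp only [relaySignal, stack_cons_add, stack_cons_of_lt _ _ h, Pi.add_apply]

theorem relaySignal_cf2 (h : j < A.rate .cf2) :
    A.relaySignal m k (A.l2 + (2 * A.rate .df1 + (2 * A.rate .df2 + (A.rate .cf1 + j)))) =
      A.sig (m 0) .cf2 (k - 1) j + A.sig (m 1) .cf2 (k - 1) j := by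
  simp only [relaySignal, stack_cons_add, stack_cons_of_lt _ _ h, Pi.add_apply]

theorem relaySignal_pad (h : j < A.l3) :
    A.relaySignal m k
      (A.l2 + (2 * A.rate .df1 + (2 * A.rate .df2 + (A.rate .cf1 + (A.rate .cf2 + j))))) = 0 := by
  simp only [relaySignal, stack_cons_add, stack_cons_of_lt _ _ h, Pi.zero_apply]

theorem relaySignal_relayAbove_add :
    A.relaySignal m k (A.relayAbove + j) = stack
      [(A.rate .cn1, A.sig (m 0) .cn1 (k - 1) + A.sig (m 1) .cn1 (k - 1)),
       (A.rate .cn2, A.sig (m 0) .cn2 (k - 1) + A.sig (m 1) .cn2 (k - 1))] j := by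
  simp only [relayAbove, relaySignal, add_assoc, stack_cons_add]

theorem relaySignal_cn1 (h : j < A.rate .cn1) :
    A.relaySignal m k (A.relayAbove + j) =
      A.sig (m 0) .cn1 (k - 1) j + A.sig (m 1) .cn1 (k - 1) j := by
  simp only [relaySignal_relayAbove_add, stack_cons_of_lt _ _ h, Pi.add_apply]

theorem relaySignal_cn2 (h : j < A.rate .cn2) :
    A.relaySignal m k (A.relayAbove + (A.rate .cn1 + j)) =
      A.sig (m 0) .cn2 (k - 1) j + A.sig (m 1) .cn2 (k - 1) j := by
  simp only [relaySignal_relayAbove_add, stack_cons_add, stack_cons_of_lt _ _ h, Pi.add_apply]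

end relay

variable {A}

theorem sig_of_rate_le (m : Fin (B - 1) → A.Payload) {c : Stream} (k : ℕ) {j : ℕ}
    (h : A.rate c ≤ j) : A.sig m c k j = 0 := dif_neg (by omega)

theorem sig_eq_of_forall_lt {m m' : Fin (B - 1) → A.Payload} {c : Stream} {k : ℕ}
    (h : ∀ j < A.rate c, A.sig m c k j = A.sig m' c k j) : A.sig m c k = A.sig m' c k := by
  funext j
  by_cases hj : j < A.rate c
  · exact h j hj
  · rw [sig_of_rate_le _ _ (not_lt.1 hj), sig_of_rate_le _ _ (not_lt.1 hj)]

theorem sig_of_block_zero (m : Fin (B - 1) → A.Payload) (c : Stream) : A.sig m c 0 = 0 := by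
  funext j; exact dif_neg (by omega)

theorem sig_of_last_block (m : Fin (B - 1) → A.Payload) (c : Stream) : A.sig m c B = 0 := by
  funext j; exact dif_neg (by omega)

theorem sig_apply (m : Fin (B - 1) → A.Payload) (c : Stream) (b : Fin (B - 1))
    (j : Fin (A.rate c)) : A.sig m c (b + 1) j = m b c j := by
  have h : (1 ≤ b.val + 1 ∧ b.val + 1 - 1 < B - 1) ∧ j.val < A.rate c :=
    ⟨⟨by omega, by omega⟩, j.isLt⟩
  rw [sig, dif_pos h]
  rfl

theorem payload_eq_of_sig_eq {m m' : Fin (B - 1) → A.Payload} {c : Stream} {b : Fin (B - 1)}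
    (h : A.sig m c (b + 1) = A.sig m' c (b + 1)) : m b c = m' b c := by
  funext j
  rw [← sig_apply m, ← sig_apply m', h]

theorem dfSig_eq_of_sig_eq (i : Fin 2) {m m' : Fin (B - 1) → A.Payload} {c : Stream} {k : ℕ}
    (h : A.sig m c k = A.sig m' c k) : A.dfSig i m c k = A.dfSig i m' c k := by
  funext j
  simp only [dfSig, h]

/-- Both users' decode-forward signals can be read off their sum. -/
theorem sig_eq_of_dfSig_add_eq {m m' : Fin 2 → Fin (B - 1) → A.Payload} {c : Stream} {k : ℕ}
    (h : ∀ j < 2 * A.rate c, A.dfSig 0 (m 0) c k j + A.dfSig 1 (m 1) c k j =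
      A.dfSig 0 (m' 0) c k j + A.dfSig 1 (m' 1) c k j) (i : Fin 2) :
    A.sig (m i) c k = A.sig (m' i) c k := by
  refine sig_eq_of_forall_lt fun j hj => ?_
  fin_cases i
  · simpa [dfSig, hj] using h j (by omega)
  · have hle : A.rate c ≤ A.rate c + j := by omega
    simpa [dfSig, sig_of_rate_le _ _ hle] using h (A.rate c + j) (by omega)

theorem add_eq_add_other {f : Fin 2 → ZMod 2} (j : Fin 2) : f 0 + f 1 = f j + f (1 - j) := by
  fin_cases j
  · rfl
  · exact add_comm _ _

/-! ### Backward decoding -/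

/-- The layout of the parameter choices used for decoding. On the cross link, the signal `u_cn[k-1]`
occupies the lowest received levels; on these levels it is neutralized. The direct link is weaker
by `E` levels. Above its neutralization signal, the relay uses levels on which the undesired user
is silent. The cross link has `C` and the link from the relay has `R` levels. -/
structure Layout (A : SIParams) (C R E : ℕ) : Prop where
  cn1_eq : A.rate .cn1 = 2 * A.rate .df1
  cm2_eq : A.rate .cm2 = 0
  l3_eq : A.l3 = A.rate .cf2
  tx_eq : A.txAbove + A.rate .cn1 + A.rate .cn2 = C
  relay_eq : A.relayAbove + A.rate .cn1 + A.rate .cn2 = R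
  shift_pos : 0 < E
  separated : A.lcm1 = 0 ∧ A.rate .cf1 = 0 ∨
    2 * A.rate .df1 + 2 * A.rate .df2 + A.rate .cf1 + A.rate .cf2 ≤ A.l1
  cmEnc_eq : A.cmEnc 0 = A.cmEnc 1
  decodable : JointlyDecodable E (A.cmEnc 0)

/-- What receiver `j` knows about block `k` after having decoded the later blocks. -/
structure KnownAt (j : Fin 2) (m m' : Fin 2 → Fin (B - 1) → A.Payload) (k : ℕ) : Prop where
  df1 : ∀ i, A.sig (m i) .df1 k = A.sig (m' i) .df1 k
  df2 : ∀ i, A.sig (m i) .df2 k = A.sig (m' i) .df2 k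
  cf1 : ∀ l, A.sig (m j) .cf1 k l + A.sig (m (1 - j)) .cf1 k l =
    A.sig (m' j) .cf1 k l + A.sig (m' (1 - j)) .cf1 k l
  cf2 : ∀ l, A.sig (m j) .cf2 k l + A.sig (m (1 - j)) .cf2 k l =
    A.sig (m' j) .cf2 k l + A.sig (m' (1 - j)) .cf2 k l
  cn1 : A.sig (m j) .cn1 k = A.sig (m' j) .cn1 k
  cn2 : A.sig (m j) .cn2 k = A.sig (m' j) .cn2 k

/-- The vector of a block after a link that attenuates it by `s` levels. -/
def attenuate (s : ℕ) (X : ℕ → ZMod 2) (l : ℕ) : ZMod 2 := if s ≤ l then X (l - s) else 0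

/-- The vector received in block `k` by receiver `j`, where the strengths of the direct, cross and
relay links, and the length of the vector, are `D`, `C`, `R` and `Q`. -/
def rxSignal (D C R Q : ℕ) (j : Fin 2) (m : Fin 2 → Fin (B - 1) → A.Payload) (k : ℕ) :
    ℕ → ZMod 2 :=
  attenuate (Q - D) (A.txSignal j (m j) k)
    + attenuate (Q - C) (A.txSignal (1 - j) (m (1 - j)) k)
    + attenuate (Q - R) (A.relaySignal m k)

section decoding

variable {D C R E Q : ℕ} {j : Fin 2} {m m' : Fin 2 → Fin (B - 1) → A.Payload} {k : ℕ}

/-- Levels are counted here from the top of the cross link. In these coordinates the undesired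
signal is unshifted, the desired one is `E` levels lower, and the relay is displaced by `C - R`,
which may be negative. -/
theorem cross_eq (hC : C ≤ Q) (hR : R ≤ Q) (hDC : D + E = C)
    (H : ∀ l < Q, A.rxSignal D C R Q j m k l = A.rxSignal D C R Q j m' k l) {l : ℕ} (hl : l < C) :
    attenuate E (A.txSignal j (m j) k) l + A.txSignal (1 - j) (m (1 - j)) k l
      + (if C ≤ l + R then A.relaySignal m k (l + R - C) else 0) =
    attenuate E (A.txSignal j (m' j) k) l + A.txSignal (1 - j) (m' (1 - j)) k l
      + (if C ≤ l + R then A.relaySignal m' k (l + R - C) else 0) := by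
  have h := H (Q - C + l) (by omega)
  have e1 : (Q - D ≤ Q - C + l) = (E ≤ l) := propext (by omega)
  have e2 : (Q - R ≤ Q - C + l) = (C ≤ l + R) := propext (by omega)
  have e3 : Q - C + l - (Q - D) = l - E := by omega
  have e4 : Q - C + l - (Q - R) = l + R - C := by omega
  simpa only [rxSignal, attenuate, Pi.add_apply, e1, e2, e3, e4, Nat.le_add_right, if_true,
    Nat.add_sub_cancel_left] using h

/-- Above the neutralized levels, the relay is silent on the levels of the undesired user's common
and compute-forward signals. -/
theorem relaySignal_silent (hA : A.Layout C R E) (m : Fin 2 → Fin (B - 1) → A.Payload) {l : ℕ}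
    (hl : l < A.lcm1 + A.rate .cf1 ∨ A.lcm1 + A.rate .cf1 + A.l1 ≤ l ∧ l < A.txAbove) :
    (if C ≤ l + R then A.relaySignal m k (l + R - C) else 0) = 0 := by
  have h1 := hA.cm2_eq
  have h2 := hA.l3_eq
  have h3 := hA.tx_eq
  have h4 := hA.relay_eq
  have h5 := hA.separated
  simp only [txAbove, relayAbove] at h3 h4 hl
  split_ifs with h
  · rcases hl with hl | hl
    -- By `separated`, either the user has nothing above its padding, or the nonzero relay streams
    -- above `cn` fit into that padding, so that only the relay's top zeros lie above it.
    · exact A.relaySignal_top m k (by omega)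
    · obtain ⟨o, ho, e⟩ : ∃ o < A.l3, l + R - C = A.l2 + (2 * A.rate .df1 + (2 * A.rate .df2 +
          (A.rate .cf1 + (A.rate .cf2 + o)))) :=
        ⟨l + R - C - (A.l2 + (2 * A.rate .df1 + (2 * A.rate .df2 +
          (A.rate .cf1 + A.rate .cf2)))), by omega, by omega⟩
      rw [e, A.relaySignal_pad m k ho]
  · rfl

theorem cmEnc_eq_zero (hA : A.Layout C R E) (i : Fin 2) : A.cmEnc i = A.cmEnc 0 := by
  fin_cases i
  · rfl
  · exact hA.cmEnc_eq.symm

/-- The relay is silent on the common levels, which therefore carry one codeword plus the other one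
shifted by `E`; no knowledge of later blocks is needed. The undesired user has the unshifted
codeword. -/
theorem cm1_eq (hA : A.Layout C R E) (hC : C ≤ Q) (hR : R ≤ Q) (hDC : D + E = C)
    (H : ∀ l < Q, A.rxSignal D C R Q j m k l = A.rxSignal D C R Q j m' k l)
    (hk : 1 ≤ k ∧ k - 1 < B - 1) (i : Fin 2) :
    m i ⟨k - 1, hk.2⟩ .cm1 = m' i ⟨k - 1, hk.2⟩ .cm1 := by
  have hlen := hA.tx_eq
  simp only [txAbove] at hlen
  have key := hA.decodable (m (1 - j) ⟨k - 1, hk.2⟩ .cm1) (m j ⟨k - 1, hk.2⟩ .cm1)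
    (m' (1 - j) ⟨k - 1, hk.2⟩ .cm1) (m' j ⟨k - 1, hk.2⟩ .cm1) fun l => by
      have h := cross_eq hC hR hDC H (l := l) (by omega)
      have hs := fun m => relaySignal_silent (k := k) hA (B := B) m (l := l) (Or.inl (by omega))
      have hcm : ∀ (i : Fin 2) (m : Fin (B - 1) → A.Payload) (l : ℕ) (hl : l < A.lcm1),
          A.txSignal i m k l = A.cmEnc 0 (m ⟨k - 1, hk.2⟩ .cm1) ⟨l, hl⟩ := by
        intro i m l hl
        rw [A.txSignal_cm1 i m k hl, cmSig, dif_pos ⟨hk, hl⟩, cmEnc_eq_zero hA]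
      rw [hs, hs, add_zero, add_zero, attenuate, attenuate, hcm _ _ _ l.isLt,
        hcm _ _ _ l.isLt, hcm _ _ _ (by omega), hcm _ _ _ (by omega)] at h
      rw [add_comm, h, add_comm]
  by_cases hi : i = j
  · rw [hi]; exact key.2
  · have : i = 1 - j := by omega
    rw [this]; exact key.1

theorem cmSig_eq (hA : A.Layout C R E) (hC : C ≤ Q) (hR : R ≤ Q) (hDC : D + E = C)
    (H : ∀ l < Q, A.rxSignal D C R Q j m k l = A.rxSignal D C R Q j m' k l) (i : Fin 2) :
    A.cmSig i (m i) k = A.cmSig i (m' i) k := by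
  funext l
  unfold cmSig
  split_ifs with h
  · rw [cm1_eq hA hC hR hDC H h.1]
  · rfl

/-- Decoding from the highest to the lowest level of the cross link. -/
theorem txSignal_eq (hA : A.Layout C R E) (hC : C ≤ Q) (hR : R ≤ Q) (hDC : D + E = C)
    (H : ∀ l < Q, A.rxSignal D C R Q j m k l = A.rxSignal D C R Q j m' k l)
    (hK : A.KnownAt j m m' k) (l : ℕ) : l < C →
    A.txSignal j (m j) k l = A.txSignal j (m' j) k l ∧
      (l < A.txAbove → A.txSignal (1 - j) (m (1 - j)) k l =
        A.txSignal (1 - j) (m' (1 - j)) k l) := by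
  induction l using Nat.strong_induction_on with
  | _ l ih =>
    intro hl
    have hcross := cross_eq hC hR hDC H hl
    -- The desired signal enters at level `l` with its bit of level `l - E`, and `E > 0` makes the
    -- induction hypothesis apply.
    have hprev : attenuate E (A.txSignal j (m j) k) l = attenuate E (A.txSignal j (m' j) k) l := by
      unfold attenuate
      split_ifs with h
      · have := hA.shift_pos
        exact (ih (l - E) (by omega) (by omega)).1
      · rfl
    rw [hprev, add_assoc, add_assoc] at hcross
    replace hcross := add_left_cancel hcross
    have h1 := hA.cm2_eq
    have h3 := hA.tx_eq
    have h4 := hA.relay_eq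
    by_cases hcm : l < A.lcm1
    · rw [A.txSignal_cm1 _ _ _ hcm, A.txSignal_cm1 _ _ _ hcm, A.txSignal_cm1 _ _ _ hcm,
        A.txSignal_cm1 _ _ _ hcm, cmSig_eq hA hC hR hDC H, cmSig_eq hA hC hR hDC H]
      exact ⟨rfl, fun _ => rfl⟩
    by_cases hcf1 : l < A.lcm1 + A.rate .cf1
    · obtain ⟨o, ho, rfl⟩ : ∃ o < A.rate .cf1, l = A.lcm1 + (A.rate .cm2 + o) :=
        ⟨l - A.lcm1, by omega, by omega⟩
      rw [relaySignal_silent hA m (Or.inl hcf1), relaySignal_silent hA m' (Or.inl hcf1), add_zero,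
        add_zero, A.txSignal_cf1 _ _ _ ho, A.txSignal_cf1 _ _ _ ho] at hcross
      rw [A.txSignal_cf1 _ _ _ ho, A.txSignal_cf1 _ _ _ ho, A.txSignal_cf1 _ _ _ ho,
        A.txSignal_cf1 _ _ _ ho]
      -- The received level gives the undesired user's bit; the known sum converts it into the
      -- desired one.
      have hsum := hK.cf1 o
      rw [hcross] at hsum
      exact ⟨add_right_cancel hsum, fun _ => hcross⟩
    by_cases hpad : l < A.lcm1 + A.rate .cf1 + A.l1
    · obtain ⟨o, ho, rfl⟩ : ∃ o < A.l1, l = A.lcm1 + (A.rate .cm2 + (A.rate .cf1 + o)) :=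
        ⟨l - A.lcm1 - A.rate .cf1, by omega, by omega⟩
      rw [A.txSignal_pad _ _ _ ho, A.txSignal_pad _ _ _ ho, A.txSignal_pad _ _ _ ho,
        A.txSignal_pad _ _ _ ho]
      exact ⟨rfl, fun _ => rfl⟩
    by_cases hcf2 : l < A.txAbove
    · have hz : l < A.lcm1 + A.rate .cf1 ∨ A.lcm1 + A.rate .cf1 + A.l1 ≤ l ∧ l < A.txAbove :=
        Or.inr ⟨not_lt.1 hpad, hcf2⟩
      have hcf2' := hcf2
      simp only [txAbove] at hcf2'
      obtain ⟨o, ho, rfl⟩ :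
          ∃ o < A.rate .cf2, l = A.lcm1 + (A.rate .cm2 + (A.rate .cf1 + (A.l1 + o))) :=
        ⟨l - A.lcm1 - A.rate .cf1 - A.l1, by omega, by omega⟩
      rw [relaySignal_silent hA m hz, relaySignal_silent hA m' hz, add_zero,
        add_zero, A.txSignal_cf2 _ _ _ ho, A.txSignal_cf2 _ _ _ ho] at hcross
      rw [A.txSignal_cf2 _ _ _ ho, A.txSignal_cf2 _ _ _ ho, A.txSignal_cf2 _ _ _ ho,
        A.txSignal_cf2 _ _ _ ho]
      have hsum := hK.cf2 o
      rw [hcross] at hsum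
      exact ⟨add_right_cancel hsum, fun _ => hcross⟩
    refine ⟨?_, fun h => absurd h hcf2⟩
    rw [if_pos (by omega), if_pos (by omega)] at hcross
    by_cases hcn1 : l < A.txAbove + A.rate .cn1
    · obtain ⟨o, ho, rfl⟩ : ∃ o < A.rate .cn1, l = A.txAbove + o :=
        ⟨l - A.txAbove, by omega, by omega⟩
      rw [show A.txAbove + o + R - C = A.relayAbove + o by omega, A.relaySignal_cn1 _ _ ho,
        A.relaySignal_cn1 _ _ ho, A.txSignal_cn1 _ _ _ ho, A.txSignal_cn1 _ _ _ ho,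
        add_eq_add_other (f := fun i => A.sig (m i) .cn1 (k - 1) o) j,
        add_eq_add_other (f := fun i => A.sig (m' i) .cn1 (k - 1) o) j,
        dfSig_eq_of_sig_eq _ (hK.df1 (1 - j))] at hcross
      rw [A.txSignal_cn1 _ _ _ ho, A.txSignal_cn1 _ _ _ ho, dfSig_eq_of_sig_eq _ (hK.df1 j)]
      -- The undesired user's bit `cn1[k-1]` occurs in its own signal and in the relay's sum, and
      -- cancels in characteristic 2.
      have h2 : (2 : ZMod 2) = 0 := rfl
      linear_combination hcross + (A.sig (m' (1 - j)) .cn1 (k - 1) o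
        - A.sig (m (1 - j)) .cn1 (k - 1) o) * h2
    · obtain ⟨o, ho, rfl⟩ : ∃ o < A.rate .cn2, l = A.txAbove + (A.rate .cn1 + o) :=
        ⟨l - A.txAbove - A.rate .cn1, by omega, by omega⟩
      rw [show A.txAbove + (A.rate .cn1 + o) + R - C = A.relayAbove + (A.rate .cn1 + o) by omega,
        A.relaySignal_cn2 _ _ ho, A.relaySignal_cn2 _ _ ho, A.txSignal_cn2 _ _ _ ho,
        A.txSignal_cn2 _ _ _ ho,
        add_eq_add_other (f := fun i => A.sig (m i) .cn2 (k - 1) o) j,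
        add_eq_add_other (f := fun i => A.sig (m' i) .cn2 (k - 1) o) j] at hcross
      rw [A.txSignal_cn2 _ _ _ ho, A.txSignal_cn2 _ _ _ ho]
      have h2 : (2 : ZMod 2) = 0 := rfl
      linear_combination hcross + (A.sig (m' (1 - j)) .cn2 (k - 1) o
        - A.sig (m (1 - j)) .cn2 (k - 1) o) * h2

/-- Above the neutralized levels both users' contributions have been decoded, so they can be
subtracted from the received vector. -/
theorem relaySignal_eq (hA : A.Layout C R E) (hC : C ≤ Q) (hR : R ≤ Q) (hDC : D + E = C)
    (H : ∀ l < Q, A.rxSignal D C R Q j m k l = A.rxSignal D C R Q j m' k l)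
    (hK : A.KnownAt j m m' k) {l : ℕ} (hl : l < A.relayAbove) :
    A.relaySignal m k l = A.relaySignal m' k l := by
  have h3 := hA.tx_eq
  have h4 := hA.relay_eq
  have h := H (Q - R + l) (by omega)
  have h1 : attenuate (Q - D) (A.txSignal j (m j) k) (Q - R + l) =
      attenuate (Q - D) (A.txSignal j (m' j) k) (Q - R + l) := by
    unfold attenuate
    split_ifs
    · exact (txSignal_eq hA hC hR hDC H hK _ (by omega)).1
    · rfl
  have h2 : attenuate (Q - C) (A.txSignal (1 - j) (m (1 - j)) k) (Q - R + l) =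
      attenuate (Q - C) (A.txSignal (1 - j) (m' (1 - j)) k) (Q - R + l) := by
    unfold attenuate
    split_ifs
    · exact (txSignal_eq hA hC hR hDC H hK _ (by omega)).2 (by omega)
    · rfl
  simp only [rxSignal, Pi.add_apply, h1, h2] at h
  simpa [attenuate] using add_left_cancel h

theorem sum_eq_of_forall_lt {c : Stream}
    (h : ∀ l < A.rate c, A.sig (m 0) c k l + A.sig (m 1) c k l =
      A.sig (m' 0) c k l + A.sig (m' 1) c k l) (l : ℕ) :
    A.sig (m j) c k l + A.sig (m (1 - j)) c k l =
      A.sig (m' j) c k l + A.sig (m' (1 - j)) c k l := by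
  rw [← add_eq_add_other (f := fun i => A.sig (m i) c k l) j,
    ← add_eq_add_other (f := fun i => A.sig (m' i) c k l) j]
  by_cases hl : l < A.rate c
  · exact h l hl
  · simp only [sig_of_rate_le _ _ (not_lt.1 hl)]

/-- One step of backward decoding: the relay signal yields the `df` bits and `cf` sums of the
previous block. The desired `cn` bits come from the receiver's own decoded vector, after removal of
the known `df1[k]`. -/
theorem KnownAt.pred (hA : A.Layout C R E) (hC : C ≤ Q) (hR : R ≤ Q) (hDC : D + E = C)
    (H : ∀ l < Q, A.rxSignal D C R Q j m k l = A.rxSignal D C R Q j m' k l)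
    (hK : A.KnownAt j m m' k) : A.KnownAt j m m' (k - 1) := by
  have h2 := hA.l3_eq
  have h3 := hA.tx_eq
  have h4 := hA.relay_eq
  have hR' := fun l => relaySignal_eq (l := l) hA hC hR hDC H hK
  simp only [relayAbove] at hR'
  refine ⟨sig_eq_of_dfSig_add_eq fun l hl => ?_, sig_eq_of_dfSig_add_eq fun l hl => ?_,
    sum_eq_of_forall_lt fun l hl => ?_, sum_eq_of_forall_lt fun l hl => ?_,
    sig_eq_of_forall_lt fun l hl => ?_, sig_eq_of_forall_lt fun l hl => ?_⟩
  · rw [← A.relaySignal_df1 m k hl, ← A.relaySignal_df1 m' k hl]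
    exact hR' _ (by omega)
  · rw [← A.relaySignal_df2 m k hl, ← A.relaySignal_df2 m' k hl]
    exact hR' _ (by omega)
  · rw [← A.relaySignal_cf1 m k hl, ← A.relaySignal_cf1 m' k hl]
    exact hR' _ (by omega)
  · rw [← A.relaySignal_cf2 m k hl, ← A.relaySignal_cf2 m' k hl]
    exact hR' _ (by omega)
  · have h := (txSignal_eq hA hC hR hDC H hK (A.txAbove + l) (by omega)).1
    rw [A.txSignal_cn1 _ _ _ hl, A.txSignal_cn1 _ _ _ hl, dfSig_eq_of_sig_eq _ (hK.df1 j)] at h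
    exact add_right_cancel h
  · have h := (txSignal_eq hA hC hR hDC H hK (A.txAbove + (A.rate .cn1 + l)) (by omega)).1
    rwa [A.txSignal_cn2 _ _ _ hl, A.txSignal_cn2 _ _ _ hl] at h

theorem knownAt (hA : A.Layout C R E) (hC : C ≤ Q) (hR : R ≤ Q) (hDC : D + E = C)
    (H : ∀ k, 1 ≤ k → k ≤ B → ∀ l < Q, A.rxSignal D C R Q j m k l = A.rxSignal D C R Q j m' k l)
    (t : ℕ) : t ≤ B → A.KnownAt j m m' (B - t) := by
  induction t with
  | zero =>
    intro _
    -- Backward decoding can start at block `B` because all fresh signals there are zero.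
    constructor <;> simp [sig_of_last_block]
  | succ t ih =>
    intro ht
    have := KnownAt.pred hA hC hR hDC (H (B - t) (by omega) (by omega)) (ih (by omega))
    rwa [Nat.sub_sub] at this

/-- Backward decoding recovers the desired message and all common signals. -/
theorem eq_of_rxSignal_eq (hA : A.Layout C R E) (hC : C ≤ Q) (hR : R ≤ Q) (hDC : D + E = C)
    (H : ∀ k, 1 ≤ k → k ≤ B → ∀ l < Q,
      A.rxSignal D C R Q j m k l = A.rxSignal D C R Q j m' k l) :
    m j = m' j ∧ ∀ i b, m i b .cm1 = m' i b .cm1 ∧ m i b .cm2 = m' i b .cm2 := by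
  have h2 := hA.cm2_eq
  have h3 := hA.tx_eq
  have hcm : ∀ i b, m i b .cm1 = m' i b .cm1 ∧ m i b .cm2 = m' i b .cm2 := by
    intro i b
    refine ⟨cm1_eq hA hC hR hDC (H (b + 1) (by omega) (by omega)) ⟨by omega, by omega⟩ i, ?_⟩
    funext l
    exact absurd l.isLt (by omega)
  refine ⟨funext fun b => funext fun c => ?_, hcm⟩
  have hK : A.KnownAt j m m' (b + 1) := by
    have := knownAt hA hC hR hDC H (B - (b + 1)) (by omega)
    rwa [show B - (B - (b.val + 1)) = b + 1 by omega] at this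
  have htx := fun l => txSignal_eq hA hC hR hDC (H (b + 1) (by omega) (by omega)) hK l
  simp only [txAbove] at h3
  cases c with
  | cm1 => exact (hcm j b).1
  | cm2 => exact (hcm j b).2
  | cf1 =>
    refine payload_eq_of_sig_eq (sig_eq_of_forall_lt fun l hl => ?_)
    rw [← A.txSignal_cf1 j _ _ hl, ← A.txSignal_cf1 j _ _ hl]
    exact (htx _ (by omega)).1
  | cf2 =>
    refine payload_eq_of_sig_eq (sig_eq_of_forall_lt fun l hl => ?_)
    rw [← A.txSignal_cf2 j _ _ hl, ← A.txSignal_cf2 j _ _ hl]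
    exact (htx _ (by omega)).1
  | df1 => exact payload_eq_of_sig_eq (hK.df1 j)
  | df2 => exact payload_eq_of_sig_eq (hK.df2 j)
  | cn1 => exact payload_eq_of_sig_eq hK.cn1
  | cn2 => exact payload_eq_of_sig_eq hK.cn2

end decoding

end SIParams
-- Causality of the relay and construction of the code
namespace SIParams

variable {A : SIParams} {B : ℕ}

section relay

variable {m m' : Fin 2 → Fin (B - 1) → A.Payload} {S k : ℕ}

theorem relaySignal_first (m : Fin 2 → Fin (B - 1) → A.Payload) : A.relaySignal m 1 = 0 := by
  have hdf : ∀ (i : Fin 2) (c : Stream), A.dfSig i (m i) c 0 = 0 := by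
    intro i c
    funext j
    simp [dfSig, sig_of_block_zero]
  funext j
  simp [relaySignal, stack, hdf, sig_of_block_zero]

/-- The relay can compute its signal from the sums of the users' vectors in the earlier blocks. -/
theorem relaySignal_eq_of_sum_eq
    (hS : A.txAbove + 2 * A.rate .cn1 + 2 * A.rate .cn2 + 2 * A.rate .df2 ≤ S)
    (hcn : A.rate .cn1 = 2 * A.rate .df1)
    (H : ∀ κ, 1 ≤ κ → κ < k → ∀ l < S,
      A.txSignal 0 (m 0) κ l + A.txSignal 1 (m 1) κ l =
        A.txSignal 0 (m' 0) κ l + A.txSignal 1 (m' 1) κ l) :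
    A.relaySignal m k = A.relaySignal m' k := by
  have hsum : ∀ (c : Stream) (κ : ℕ), (∀ l < A.rate c, A.sig (m 0) c κ l + A.sig (m 1) c κ l =
      A.sig (m' 0) c κ l + A.sig (m' 1) c κ l) →
      A.sig (m 0) c κ + A.sig (m 1) c κ = A.sig (m' 0) c κ + A.sig (m' 1) c κ := fun c κ h =>
    funext fun l => sum_eq_of_forall_lt (j := 0) h l
  have hS' := hS
  simp only [txAbove] at hS'
  have hcn1 : ∀ κ < k, A.sig (m 0) .cn1 κ + A.sig (m 1) .cn1 κ =
      A.sig (m' 0) .cn1 κ + A.sig (m' 1) .cn1 κ := by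
    intro κ hκ
    rcases Nat.eq_zero_or_pos κ with rfl | hpos
    · simp only [sig_of_block_zero]
    · refine hsum _ _ fun l hl => ?_
      have h := H κ hpos hκ
        (A.txAbove + (A.rate .cn1 + (A.rate .cn2 + (2 * A.rate .df2 + l)))) (by omega)
      rwa [A.txSignal_fresh_cn1 _ _ _ hl, A.txSignal_fresh_cn1 _ _ _ hl,
        A.txSignal_fresh_cn1 _ _ _ hl, A.txSignal_fresh_cn1 _ _ _ hl] at h
  rcases Nat.lt_or_ge 1 k with hk | hk
  · have hcn2 : A.sig (m 0) .cn2 (k - 1) + A.sig (m 1) .cn2 (k - 1) =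
        A.sig (m' 0) .cn2 (k - 1) + A.sig (m' 1) .cn2 (k - 1) := by
      refine hsum _ _ fun l hl => ?_
      have h := H (k - 1) (by omega) (by omega) (A.txAbove + (A.rate .cn1 + (A.rate .cn2 +
        (2 * A.rate .df2 + (A.rate .cn1 + l))))) (by omega)
      rwa [A.txSignal_fresh_cn2 _ _ _ hl, A.txSignal_fresh_cn2 _ _ _ hl,
        A.txSignal_fresh_cn2 _ _ _ hl, A.txSignal_fresh_cn2 _ _ _ hl] at h
    have hcf1 : A.sig (m 0) .cf1 (k - 1) + A.sig (m 1) .cf1 (k - 1) =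
        A.sig (m' 0) .cf1 (k - 1) + A.sig (m' 1) .cf1 (k - 1) := by
      refine hsum _ _ fun l hl => ?_
      have h := H (k - 1) (by omega) (by omega) (A.lcm1 + (A.rate .cm2 + l)) (by omega)
      rwa [A.txSignal_cf1 _ _ _ hl, A.txSignal_cf1 _ _ _ hl,
        A.txSignal_cf1 _ _ _ hl, A.txSignal_cf1 _ _ _ hl] at h
    have hcf2 : A.sig (m 0) .cf2 (k - 1) + A.sig (m 1) .cf2 (k - 1) =
        A.sig (m' 0) .cf2 (k - 1) + A.sig (m' 1) .cf2 (k - 1) := by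
      refine hsum _ _ fun l hl => ?_
      have h := H (k - 1) (by omega) (by omega)
        (A.lcm1 + (A.rate .cm2 + (A.rate .cf1 + (A.l1 + l)))) (by omega)
      rwa [A.txSignal_cf2 _ _ _ hl, A.txSignal_cf2 _ _ _ hl,
        A.txSignal_cf2 _ _ _ hl, A.txSignal_cf2 _ _ _ hl] at h
    have hdf2 : ∀ i, A.sig (m i) .df2 (k - 1) = A.sig (m' i) .df2 (k - 1) := by
      refine sig_eq_of_dfSig_add_eq fun l hl => ?_
      have h := H (k - 1) (by omega) (by omega)
        (A.txAbove + (A.rate .cn1 + (A.rate .cn2 + l))) (by omega)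
      rwa [A.txSignal_df2 _ _ _ hl, A.txSignal_df2 _ _ _ hl,
        A.txSignal_df2 _ _ _ hl, A.txSignal_df2 _ _ _ hl] at h
    -- In block `k - 1` these bits are superposed on `cn1[k-2]`, whose sum the relay already heard
    -- as a fresh signal one block earlier.
    have hdf1 : ∀ i, A.sig (m i) .df1 (k - 1) = A.sig (m' i) .df1 (k - 1) := by
      refine sig_eq_of_dfSig_add_eq fun l hl => ?_
      rw [← hcn] at hl
      have h := H (k - 1) (by omega) (by omega) (A.txAbove + l) (by omega)
      rw [A.txSignal_cn1 _ _ _ hl, A.txSignal_cn1 _ _ _ hl,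
        A.txSignal_cn1 _ _ _ hl, A.txSignal_cn1 _ _ _ hl] at h
      have h' := congrFun (hcn1 (k - 1 - 1) (by omega)) l
      simp only [Pi.add_apply] at h'
      linear_combination h - h'
    simp only [relaySignal, hcn1 (k - 1) (by omega), hcn2, hcf1, hcf2,
      dfSig_eq_of_sig_eq _ (hdf1 _), dfSig_eq_of_sig_eq _ (hdf2 _)]
  · have h0 : k - 1 = 0 := by omega
    have hdf : ∀ (i : Fin 2) (c : Stream), A.dfSig i (m i) c 0 = A.dfSig i (m' i) c 0 :=
      fun i c => dfSig_eq_of_sig_eq i (by rw [sig_of_block_zero, sig_of_block_zero])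
    simp only [relaySignal, h0, hdf, sig_of_block_zero]

end relay

section code

variable {p : LDIRC} {L : ℕ} {M : Fin 2 → ℕ}

/-- The symbol of the `t`-th channel use, when the vector of block `k` is `X k`. -/
def symbol (p : LDIRC) (L : ℕ) (X : ℕ → ℕ → ZMod 2) (t : ℕ) : p.Vec :=
  fun l => X (t / L + 1) (l.val * L + t % L)

/-- Moving one symbol level skips one bit of each of the `L` interleaved symbols, hence `L` levels
of the block vector. -/
theorem link_symbol (hL : 0 < L) (s : ℕ) (X : ℕ → ℕ → ZMod 2) (t : ℕ) :
    p.link s (symbol p L X t) =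
      symbol p L (fun k => attenuate (L * p.q - L * s) (X k)) t := by
  funext l
  have hr := Nat.mod_lt t hL
  rw [link_apply]
  simp only [symbol, attenuate]
  rw [← Nat.mul_sub, mul_comm L]
  by_cases h : p.q - s ≤ l.val
  · have := Nat.mul_le_mul_right L h
    rw [if_pos h, if_pos (by omega), Nat.sub_mul (l.val)]
    congr 1
    omega
  · have := Nat.mul_le_mul_right L (Nat.succ_le_of_lt (not_le.1 h))
    rw [Nat.succ_mul] at this
    rw [if_neg h, if_neg (by omega)]

theorem symbol_add (X Y : ℕ → ℕ → ZMod 2) (t : ℕ) :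
    symbol p L X t + symbol p L Y t = symbol p L (fun k => X k + Y k) t := rfl

/-- Deinterleaving: level `l` of a block is bit `l / L` of its channel use `l % L`; blocks count
from 1, channel uses from 0. -/
theorem eq_of_symbol_eq {X Y : ℕ → ℕ → ZMod 2} {k l : ℕ} (hL : 0 < L) (hl : l < L * p.q)
    (h : symbol p L X (k * L + l % L) = symbol p L Y (k * L + l % L)) :
    X (k + 1) l = Y (k + 1) l := by
  have := congrFun h ⟨l / L, Nat.div_lt_of_lt_mul hl⟩
  have h1 : (k * L + l % L) / L = k := by
    rw [mul_comm, Nat.mul_add_div hL, Nat.div_eq_of_lt (Nat.mod_lt _ hL), add_zero]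
  have h2 : (k * L + l % L) % L = l % L := by
    rw [mul_comm, Nat.mul_add_mod, Nat.mod_mod]
  simpa only [symbol, h1, h2, Nat.div_add_mod'] using this

theorem block_time_lt {k κ B L : ℕ} (hL : 0 < L) (h : κ < k) (hk : k ≤ B) (l : ℕ) :
    κ * L + l % L < B * L := by
  have h1 := Nat.mul_le_mul_right L (Nat.succ_le_of_lt (h.trans_le hk))
  have h2 := Nat.mod_lt l hL
  rw [Nat.succ_mul] at h1
  omega

variable (A p L B)

variable (msg : (i : Fin 2) → Fin (M i) ≃ (Fin (B - 1) → A.Payload))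

/-- The output of the relay in scheme SI. -/
def siRelayOutput (w : (i : Fin 2) → Fin (M i)) (t : ℕ) : p.Vec :=
  p.link p.ns (symbol p L (A.txSignal 0 (msg 0 (w 0))) t)
    + p.link p.ns (symbol p L (A.txSignal 1 (msg 1 (w 1))) t)

/-- The signal at receiver `j` in scheme SI. -/
def siOutput (j : Fin 2) (w : (i : Fin 2) → Fin (M i)) (t : ℕ) : p.Vec :=
  p.link p.nd (symbol p L (A.txSignal j (msg j (w j))) t)
    + p.link p.nc (symbol p L (A.txSignal (1 - j) (msg (1 - j) (w (1 - j)))) t)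
    + p.link p.nr (symbol p L (A.relaySignal fun i => msg i (w i)) t)

open Classical in
/-- The code of scheme SI. -/
noncomputable def siCode : Code p (B * L) M where
  enc i w t := symbol p L (A.txSignal i (msg i w)) t
  -- Any messages consistent with the past will do, since they all give the same current relay
  -- signal.
  relay k y := if h : ∃ w, ∀ l : Fin k.val, siRelayOutput A B p L msg w l = y l then
    symbol p L (A.relaySignal fun i => msg i (h.choose i)) k else 0
  relay_first := by
    intro k y hk
    split_ifs with h
    · funext l
      simp [symbol, hk, relaySignal_first]
    · rfl
  -- The default `0` concerns only outputs that no message pair produces.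
  dec j y := if h : ∃ w, (fun t : Fin (B * L) => siOutput A B p L msg j w t) = y then h.choose j
    else (msg j).symm 0

variable {A p L B msg}

/-- The relay signal of a block depends only on the past outputs of the relay. -/
theorem relaySignal_eq_of_siRelayOutput_eq (hA : A.Valid p L) (hL : 0 < L)
    {w w' : (i : Fin 2) → Fin (M i)} {t : ℕ}
    (h : ∀ l < t, siRelayOutput A B p L msg w l = siRelayOutput A B p L msg w' l) :
    A.relaySignal (fun i => msg i (w i)) (t / L + 1) =
      A.relaySignal (fun i => msg i (w' i)) (t / L + 1) := by
  refine relaySignal_eq_of_sum_eq hA.tx_le hA.cn1_eq fun κ h1 hκ l hl => ?_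
  have hq : L * p.ns ≤ L * p.q := Nat.mul_le_mul_left L ns_le_q
  have ht := Nat.div_mul_le_self t L
  obtain ⟨κ, rfl⟩ : ∃ κ', κ = κ' + 1 := ⟨κ - 1, by omega⟩
  have hlt := block_time_lt hL (Nat.lt_of_succ_lt_succ hκ) le_rfl
    (L * p.q - L * p.ns + l)
  have := h _ (hlt.trans_le ht)
  simp only [siRelayOutput, link_symbol hL, symbol_add] at this
  simpa [attenuate] using eq_of_symbol_eq hL (by omega) this

theorem siCode_relayInput (hA : A.Valid p L) (hL : 0 < L) (w : (i : Fin 2) → Fin (M i))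
    (t : Fin (B * L)) :
    (siCode A B p L msg).relayInput w t = symbol p L (A.relaySignal fun i => msg i (w i)) t := by
  have h : ∃ w', ∀ l : Fin t.val, siRelayOutput A B p L msg w' l =
      (siCode A B p L msg).relayOutput w ⟨l.val, l.isLt.trans t.isLt⟩ := ⟨w, fun _ => rfl⟩
  unfold Code.relayInput
  refine (dif_pos h).trans ?_
  unfold symbol
  rw [relaySignal_eq_of_siRelayOutput_eq (w := h.choose) (w' := w) hA hL
    fun l hl => h.choose_spec ⟨l, hl⟩]

theorem siCode_output (hA : A.Valid p L) (hL : 0 < L) (j : Fin 2) (w : (i : Fin 2) → Fin (M i)) :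
    (siCode A B p L msg).output j w = fun t : Fin (B * L) => siOutput A B p L msg j w t := by
  funext t
  unfold Code.output
  rw [siCode_relayInput hA hL]
  rfl

theorem rxSignal_eq_of_siOutput_eq (hL : 0 < L) {j : Fin 2} {w w' : (i : Fin 2) → Fin (M i)}
    (h : ∀ t < B * L, siOutput A B p L msg j w t = siOutput A B p L msg j w' t) {k : ℕ}
    (hk : 1 ≤ k) (hkB : k ≤ B) {l : ℕ} (hl : l < L * p.q) :
    A.rxSignal (L * p.nd) (L * p.nc) (L * p.nr) (L * p.q) j (fun i => msg i (w i)) k l =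
      A.rxSignal (L * p.nd) (L * p.nc) (L * p.nr) (L * p.q) j (fun i => msg i (w' i)) k l := by
  obtain ⟨k, rfl⟩ : ∃ k', k = k' + 1 := ⟨k - 1, by omega⟩
  have := h _ (block_time_lt hL (Nat.lt_of_succ_le hkB) le_rfl l)
  simp only [siOutput, link_symbol hL, symbol_add] at this
  exact eq_of_symbol_eq hL hl this

theorem eq_of_siOutput_eq {E : ℕ} (hlay : A.Layout (L * p.nc) (L * p.nr) E)
    (hE : L * p.nd + E = L * p.nc) (hL : 0 < L) {j : Fin 2} {w w' : (i : Fin 2) → Fin (M i)}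
    (h : (fun t : Fin (B * L) => siOutput A B p L msg j w t) =
      fun t : Fin (B * L) => siOutput A B p L msg j w' t) :
    w j = w' j ∧ ∀ i b, msg i (w i) b .cm1 = msg i (w' i) b .cm1 ∧
      msg i (w i) b .cm2 = msg i (w' i) b .cm2 := by
  have := eq_of_rxSignal_eq (m := fun i => msg i (w i)) (m' := fun i => msg i (w' i)) (j := j) hlay
    (Nat.mul_le_mul_left L nc_le_q) (Nat.mul_le_mul_left L nr_le_q) hE
    fun k hk hkB l hl => rxSignal_eq_of_siOutput_eq hL (fun t ht => congrFun h ⟨t, ht⟩) hk hkB hl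
  exact ⟨(msg j).injective this.1, this.2⟩

theorem siCode_correct {E : ℕ} (hA : A.Valid p L) (hlay : A.Layout (L * p.nc) (L * p.nr) E)
    (hE : L * p.nd + E = L * p.nc) (hL : 0 < L) (w : (i : Fin 2) → Fin (M i)) :
    (siCode A B p L msg).Correct w := by
  intro j
  have h : ∃ w', (fun t : Fin (B * L) => siOutput A B p L msg j w' t) =
      (siCode A B p L msg).output j w := ⟨w, (siCode_output hA hL j w).symm⟩
  refine (dif_pos h).trans (eq_of_siOutput_eq (msg := msg) hlay hE hL ?_).1
  rw [h.choose_spec, siCode_output hA hL]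

theorem siCode_isSchemeSI {E : ℕ} (hA : A.Valid p L) (hlay : A.Layout (L * p.nc) (L * p.nr) E)
    (hE : L * p.nd + E = L * p.nc) (hL : 0 < L) :
    A.IsSchemeSI p L B (siCode A B p L msg) := by
  refine ⟨hA, msg, fun i w t l => rfl, fun w t l => ?_, fun j w w' h => ?_⟩
  · rw [siCode_relayInput hA hL]
    rfl
  · rw [siCode_output hA hL, siCode_output hA hL] at h
    exact (eq_of_siOutput_eq hlay hE hL h).2

variable (A B)

theorem card_messages : Fintype.card (Fin (B - 1) → A.Payload) = 2 ^ ((B - 1) * A.bits) := by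
  simp [bits, Finset.prod_pow_eq_pow_sum, ← pow_mul, mul_comm]

end code

end SIParams

theorem Code.errorProb_eq_zero {p : LDIRC} {n : ℕ} {M : Fin 2 → ℕ} {C : Code p n M}
    (h : ∀ w, C.Correct w) : C.errorProb = 0 := by
  have : IsEmpty {w : (i : Fin 2) → Fin (M i) // ∃ j, C.dec j (C.output j w) ≠ w j} :=
    ⟨fun w => w.2.elim fun j hj => hj (h w.1 j)⟩
  rw [errorProb, Nat.card_of_isEmpty, Nat.cast_zero, zero_div]

namespace SIParams

variable {A : SIParams} {p : LDIRC} {L E : ℕ}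

theorem exists_code (hA : A.Valid p L) (hlay : A.Layout (L * p.nc) (L * p.nr) E)
    (hE : L * p.nd + E = L * p.nc) (hL : 0 < L) (B : ℕ) :
    ∃ C : Code p (B * L) fun _ => 2 ^ ((B - 1) * A.bits),
      A.IsSchemeSI p L B C ∧ ∀ w, C.Correct w :=
  ⟨siCode A B p L fun _ => (Fintype.equivFinOfCardEq (card_messages A B)).symm,
    siCode_isSchemeSI hA hlay hE hL, siCode_correct hA hlay hE hL⟩

end SIParams
-- Choice of the parameters
namespace SIParams

/-- Parameters without uncoded common signal, and with `l3` as in `Layout`. -/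
def ofLengths (cm1 cf1 cf2 df1 df2 cn2 lcm1 l1 l2 : ℕ)
    (enc : (Fin cm1 → ZMod 2) → Fin lcm1 → ZMod 2) : SIParams where
  rate := fun
    | .cm1 => cm1
    | .cm2 => 0
    | .cf1 => cf1
    | .cf2 => cf2
    | .df1 => df1
    | .df2 => df2
    | .cn1 => 2 * df1
    | .cn2 => cn2
  lcm1 := lcm1
  l1 := l1
  l2 := l2
  l3 := cf2
  cmEnc := fun _ => enc

/-- Parameters of scheme SI, with blocks of two channel uses, that achieve its sum-rate. -/
def Optimal (A : SIParams) (p : LDIRC) : Prop :=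
  A.Valid p 2 ∧ A.Layout (2 * p.nc) (2 * p.nr) (2 * (p.nc - p.nd)) ∧ (A.bits : ℤ) = p.siSumRate

/-- Two channel uses per block allow the users to have equal rates even if the sum-rate is odd: each
carries `siSumRate` bits per block. The length constraints account for the cross, relay and
source–relay links. -/
theorem ofLengths_optimal (hSI : p.nd < p.nc) {cm1 cf1 cf2 df1 df2 cn2 lcm1 l1 l2 : ℕ}
    {enc : (Fin cm1 → ZMod 2) → Fin lcm1 → ZMod 2}
    (henc : JointlyDecodable (2 * (p.nc - p.nd)) enc)
    (htx : lcm1 + cf1 + l1 + cf2 + 2 * df1 + cn2 = 2 * p.nc)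
    (hrelay : l2 + 4 * df1 + 2 * df2 + cf1 + 2 * cf2 + cn2 = 2 * p.nr)
    (hs : lcm1 + cf1 + l1 + cf2 + 4 * df1 + 2 * df2 + 2 * cn2 ≤ 2 * p.ns)
    (hsep : lcm1 = 0 ∧ cf1 = 0 ∨ 2 * df1 + 2 * df2 + cf1 + cf2 ≤ l1)
    (hrate : ((cm1 + cf1 + cf2 + 3 * df1 + df2 + cn2 : ℕ) : ℤ) = p.siSumRate) :
    (ofLengths cm1 cf1 cf2 df1 df2 cn2 lcm1 l1 l2 enc).Optimal p := by
  have hbits : (ofLengths cm1 cf1 cf2 df1 df2 cn2 lcm1 l1 l2 enc).bits =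
      cm1 + (0 + (cf1 + (cf2 + (df1 + (df2 + (2 * df1 + (cn2 + 0))))))) := rfl
  refine ⟨⟨rfl, ?_, ?_, ?_⟩, ⟨rfl, rfl, rfl, ?_, ?_, by omega, hsep, rfl, henc⟩, ?_⟩
  · simp only [txAbove, ofLengths]; omega
  · simp only [relayAbove, ofLengths]; omega
  · simp only [txAbove, relayAbove, ofLengths]; omega
  · simp only [txAbove, ofLengths]; omega
  · simp only [relayAbove, ofLengths]; omega
  · rw [hbits, ← hrate]; push_cast; ring

theorem jointlyDecodable_of_isEmpty {l E : ℕ} (enc : (Fin 0 → ZMod 2) → Fin l → ZMod 2) :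
    JointlyDecodable E enc :=
  fun _ _ _ _ _ => ⟨Subsingleton.elim _ _, Subsingleton.elim _ _⟩

/-- Without common signals, the conditions on the parameters are linear. -/
theorem exists_optimal_of_lengths (hSI : p.nd < p.nc) (cf1 cf2 df1 df2 cn2 l1 l2 : ℕ)
    (htx : cf1 + l1 + cf2 + 2 * df1 + cn2 = 2 * p.nc)
    (hrelay : l2 + 4 * df1 + 2 * df2 + cf1 + 2 * cf2 + cn2 = 2 * p.nr)
    (hs : cf1 + l1 + cf2 + 4 * df1 + 2 * df2 + 2 * cn2 ≤ 2 * p.ns)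
    (hsep : cf1 = 0 ∨ 2 * df1 + 2 * df2 + cf1 + cf2 ≤ l1)
    (hrate : ((cf1 + cf2 + 3 * df1 + df2 + cn2 : ℕ) : ℤ) = p.siSumRate) :
    ∃ A : SIParams, A.Optimal p :=
  ⟨_, ofLengths_optimal (cm1 := 0) (lcm1 := 0) hSI (jointlyDecodable_of_isEmpty 0)
    (by simpa using htx) hrelay (by simpa using hs) (by simpa using hsep)
    (by simpa using hrate)⟩

theorem exists_optimal_of_nr_le_nd (hSI : p.nd < p.nc) (hs : p.nc < p.ns) (hr : p.nr ≤ p.nd) :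
    ∃ A : SIParams, A.Optimal p := by
  have hS : p.siSumRate = min (2 * p.nd) (min p.ns (p.nc + p.nr)) := by
    unfold siSumRate
    omega
  obtain ⟨S, hS'⟩ : ∃ S : ℕ, p.siSumRate = S := ⟨_, hS.trans (by norm_cast)⟩
  rw [hS'] at hS
  -- For `S ≥ nc`, neutralized levels carry `2 * (S - nc)` bits, and the other `2 * (2 * nc - S)`
  -- levels carry common signals at half density; `S ≤ 2 * nd` makes the shift small enough. For `S
  -- < nc` one has `S = 2 * nd`, and uncoded common signals suffice without the relay.
  rcases le_or_gt p.nc S with h | h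
  · obtain ⟨enc, henc⟩ := exists_jointlyDecodable_of_shift_le (m := 2 * p.nc - S)
      (E := 2 * (p.nc - p.nd)) (by omega) (by omega)
    refine ⟨_, ofLengths_optimal (cf1 := 0) (cf2 := 0) (df1 := 0) (df2 := 0)
      (cn2 := 2 * (S - p.nc)) (l1 := 0) (l2 := 2 * p.nr - 2 * (S - p.nc)) hSI henc
      ?_ ?_ ?_ ?_ ?_⟩ <;> omega
  · obtain ⟨enc, henc⟩ := exists_jointlyDecodable_of_le_shift (m := 2 * p.nd)
      (l := 2 * p.nc) (E := 2 * (p.nc - p.nd)) (by omega) (by omega)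
    refine ⟨_, ofLengths_optimal (cf1 := 0) (cf2 := 0) (df1 := 0) (df2 := 0)
      (cn2 := 0) (l1 := 0) (l2 := 2 * p.nr) hSI henc ?_ ?_ ?_ ?_ ?_⟩ <;> omega

theorem exists_optimal_of_nr_le_nc (hSI : p.nd < p.nc) (hs : p.nc < p.ns) (hr : p.nd ≤ p.nr)
    (hr' : p.nr ≤ p.nc) : ∃ A : SIParams, A.Optimal p := by
  have hS : p.siSumRate = min (2 * p.nr) p.ns := by
    unfold siSumRate
    omega
  -- Compute-forward replaces the common signals. When the sum-rate is at least `nc`, the levels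
  -- that are not neutralized are shared equally by `cf1` and a padding for the relay's sums.
  -- Otherwise the rate is `2 * nr`, and `cf1` alone provides it.
  rcases le_or_gt p.nc (min (2 * p.nr) p.ns) with h | h
  · exact exists_optimal_of_lengths hSI (2 * p.nc - min (2 * p.nr) p.ns) 0 0 0
      (2 * (min (2 * p.nr) p.ns - p.nc)) (2 * p.nc - min (2 * p.nr) p.ns)
      (2 * p.nr - min (2 * p.nr) p.ns)
      (by omega) (by omega) (by omega) (by omega) (by omega)
  · exact exists_optimal_of_lengths hSI (2 * p.nr) 0 0 0 0 (2 * p.nc - 2 * p.nr) 0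
      (by omega) (by omega) (by omega) (by omega) (by omega)

theorem exists_optimal_of_nc_le_nr (hSI : p.nd < p.nc) (hs : p.nc < p.ns) (hr : p.nc ≤ p.nr) :
    ∃ A : SIParams, A.Optimal p := by
  have hS : p.siSumRate = min (p.nr + (p.ns - p.nc) : ℤ) (min (p.ns + p.nc) (p.nc + p.nr)) := by
    unfold siSumRate
    omega
  -- With the excesses `σ` and `ρ` the target is `nc + min (ρ + σ, nc + σ, nc + ρ)`, and the cases
  -- decide which term is least. As `cm1` and `cf1` are empty, no separation is needed. Natural
  -- subtraction is used on purpose: `ρ + σ - nc` is the positive part.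
  obtain ⟨σ, hσ⟩ : ∃ σ, p.ns = p.nc + σ := ⟨p.ns - p.nc, by omega⟩
  obtain ⟨ρ, hρ⟩ : ∃ ρ, p.nr = p.nc + ρ := ⟨p.nr - p.nc, by omega⟩
  rcases le_total ρ σ with h | h
  · rcases le_total p.nc σ with h' | h'
    · exact exists_optimal_of_lengths hSI 0 0 (min p.nc ρ) (ρ - p.nc)
        (2 * p.nc - 2 * min p.nc ρ) 0
        (2 * p.nr - 2 * p.nc - 2 * min p.nc ρ - 2 * (ρ - p.nc))
        (by omega) (by omega) (by omega) (by omega) (by omega)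
    · exact exists_optimal_of_lengths hSI 0 (p.nc + ρ - σ - (ρ + σ - p.nc)) (ρ + σ - p.nc) 0
        (2 * σ - 2 * (ρ + σ - p.nc))
        (2 * p.nc - 2 * σ - (p.nc + ρ - σ - (ρ + σ - p.nc)))
        (2 * p.nr - 2 * (ρ + σ - p.nc) - 2 * σ - 2 * (p.nc + ρ - σ - (ρ + σ - p.nc)))
        (by omega) (by omega) (by omega) (by omega) (by omega)
  · rcases le_total ρ p.nc with h' | h'
    · exact exists_optimal_of_lengths hSI 0 (p.nc + ρ - σ - (ρ + σ - p.nc)) (ρ + σ - p.nc) 0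
        (2 * σ - 2 * (ρ + σ - p.nc))
        (2 * p.nc - 2 * σ - (p.nc + ρ - σ - (ρ + σ - p.nc)))
        (2 * p.nr - 2 * (ρ + σ - p.nc) - 2 * σ - 2 * (p.nc + ρ - σ - (ρ + σ - p.nc)))
        (by omega) (by omega) (by omega) (by omega) (by omega)
    · rcases le_total ρ (p.nc + σ) with h'' | h''
      · exact exists_optimal_of_lengths hSI 0 (2 * (ρ - σ)) (p.nc + σ - ρ) (ρ - p.nc) 0 0 0
          (by omega) (by omega) (by omega) (by omega) (by omega)
      · exact exists_optimal_of_lengths hSI 0 (2 * p.nc) 0 σ 0 0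
          (2 * p.nr - 4 * p.nc - 2 * σ)
          (by omega) (by omega) (by omega) (by omega) (by omega)

theorem exists_optimal (hSI : p.nd < p.nc) (hs : p.nc < p.ns) : ∃ A : SIParams, A.Optimal p := by
  rcases le_total p.nr p.nd with h | h
  · exact exists_optimal_of_nr_le_nd hSI hs h
  rcases le_total p.nr p.nc with h' | h'
  · exact exists_optimal_of_nr_le_nc hSI hs h h'
  · exact exists_optimal_of_nc_le_nr hSI hs h'

end SIParams

/-! ### Achievable rates from codes without errors -/

namespace Code

variable {p : LDIRC} {n n' : ℕ} {M M' : Fin 2 → ℕ}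

/-- Use a code with fewer messages, and stay silent in additional channel uses. -/
def extend (C : Code p n M) (hn : n ≤ n') (hM : ∀ i, M' i ≤ M i) (hM' : ∀ i, 0 < M' i) :
    Code p n' M' where
  enc i w t := if h : t.val < n then C.enc i (Fin.castLE (hM i) w) ⟨t, h⟩ else 0
  relay k y := if h : k.val < n then C.relay ⟨k, h⟩ y else 0
  relay_first k y hk := by
    split_ifs with h
    · exact C.relay_first ⟨k, h⟩ y hk
    · rfl
  dec i y :=
    if h : (C.dec i fun t => y (Fin.castLE hn t)).val < M' i then ⟨_, h⟩ else ⟨0, hM' i⟩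

theorem extend_output (C : Code p n M) (hn : n ≤ n') (hM : ∀ i, M' i ≤ M i)
    (hM' : ∀ i, 0 < M' i) (j : Fin 2) (w : (i : Fin 2) → Fin (M' i)) (t : Fin n) :
    (C.extend hn hM hM').output j w (Fin.castLE hn t) =
      C.output j (fun i => Fin.castLE (hM i) (w i)) t := by
  have henc : ∀ (l : ℕ) (h : l < n) (h' : l < n') (i : Fin 2),
      (C.extend hn hM hM').enc i (w i) ⟨l, h'⟩ = C.enc i (Fin.castLE (hM i) (w i)) ⟨l, h⟩ :=
    fun l h _ _ => dif_pos h
  have hrelay : (C.extend hn hM hM').relayInput w (Fin.castLE hn t) =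
      C.relayInput (fun i => Fin.castLE (hM i) (w i)) t := by
    unfold relayInput
    refine (dif_pos t.isLt).trans (congrArg (C.relay t) (funext fun l => ?_))
    unfold relayOutput
    rw [henc _ (l.isLt.trans t.isLt), henc _ (l.isLt.trans t.isLt)]
  unfold output
  rw [hrelay]
  have := henc t t.isLt (t.isLt.trans_le hn)
  simp only [Fin.castLE, this]

theorem extend_correct {C : Code p n M} (hC : ∀ w, C.Correct w) (hn : n ≤ n')
    (hM : ∀ i, M' i ≤ M i) (hM' : ∀ i, 0 < M' i) (w : (i : Fin 2) → Fin (M' i)) :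
    (C.extend hn hM hM').Correct w := by
  intro j
  have h := hC (fun i => Fin.castLE (hM i) (w i)) j
  have ho : (fun t => (C.extend hn hM hM').output j w (Fin.castLE hn t)) =
      C.output j fun i => Fin.castLE (hM i) (w i) :=
    funext fun t => C.extend_output hn hM hM' j w t
  have hd : (C.dec j fun t => (C.extend hn hM hM').output j w (Fin.castLE hn t)).val = w j := by
    rw [ho, h]; rfl
  refine (dif_pos (hd.trans_lt (w j).isLt)).trans (Fin.ext hd)

theorem nonempty (hM : ∀ i, 0 < M i) : Nonempty (Code p n M) :=
  ⟨⟨fun _ _ _ => 0, fun _ _ => 0, fun _ _ _ => rfl, fun i _ => ⟨0, hM i⟩⟩⟩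

end Code

/-- Arbitrary codes can fill the lengths not covered, since only the limit of the error probability
matters. -/
theorem achievable_of_eventually {R : Fin 2 → ℝ} (hR : ∀ i, 0 ≤ R i)
    (h : ∀ᶠ n : ℕ in atTop, ∃ C : Code p n fun i => ⌊(2 : ℝ) ^ ((n : ℝ) * R i)⌋₊,
      ∀ w, C.Correct w) : p.Achievable R := by
  classical
  have hpos : ∀ (n : ℕ) (i : Fin 2), 0 < ⌊(2 : ℝ) ^ ((n : ℝ) * R i)⌋₊ := fun n i =>
    Nat.floor_pos.2 (one_le_two_rpow_mul (hR i) n)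
  refine ⟨hR, fun n => if hn : ∃ C : Code p n fun i => ⌊(2 : ℝ) ^ ((n : ℝ) * R i)⌋₊,
    ∀ w, C.Correct w then hn.choose else (Code.nonempty (hpos n)).some, ?_⟩
  refine tendsto_const_nhds.congr' (h.mono fun n hn => ?_)
  simp only [dif_pos hn]
  exact (Code.errorProb_eq_zero hn.choose_spec).symm

/-- Codes of length `B * L` that carry `(B - 1) * b` bits without errors achieve all rates below
`b / L`. -/
theorem achievable_of_codes {L b : ℕ} (hL : 0 < L)
    (hC : ∀ B : ℕ, ∃ C : Code p (B * L) fun _ => 2 ^ ((B - 1) * b), ∀ w, C.Correct w) {r : ℝ}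
    (hr : 0 ≤ r) (hrb : r * L < b ∨ r = 0) : p.Achievable fun _ => r := by
  have hL' : (0 : ℝ) < L := by exact_mod_cast hL
  have hlen : ∀ᶠ n : ℕ in atTop, (n : ℝ) * r ≤ ((n / L - 1) * b : ℕ) := by
    rcases hrb with hrb | rfl
    -- From this threshold on, the slack `n * (b - r * L)` is at least `2 * b * L`. This pays for
    -- the incomplete block lost by rounding and for the last block, which carries no fresh bits.
    · filter_upwards [(tendsto_natCast_atTop_atTop (R := ℝ)).eventually_ge_atTop
        (2 * b * L / (b - r * L))] with n hn
      rw [div_le_iff₀ (sub_pos.2 hrb)] at hn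
      have h1 : (n : ℝ) < L * ((n / L : ℕ) + 1) := by
        exact_mod_cast Nat.lt_mul_div_succ n hL
      have h2 : ((n / L : ℕ) : ℝ) ≤ (n / L - 1 : ℕ) + 1 := by
        exact_mod_cast le_tsub_add
      have h3 := mul_le_mul_of_nonneg_left h2 hL'.le
      have h4 : (n : ℝ) * b ≤ L * ((n / L - 1 : ℕ) + 2) * b :=
        mul_le_mul_of_nonneg_right (by linarith) b.cast_nonneg
      rw [Nat.cast_mul]
      refine le_of_mul_le_mul_right ?_ hL'
      linarith
    · exact Eventually.of_forall fun n => by rw [mul_zero]; positivity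
  refine achievable_of_eventually (fun _ => hr) (hlen.mono fun n hn => ?_)
  obtain ⟨C, hC⟩ := hC (n / L)
  have hM : ⌊(2 : ℝ) ^ ((n : ℝ) * r)⌋₊ ≤ 2 ^ ((n / L - 1) * b) := by
    have := Real.rpow_le_rpow_of_exponent_le one_le_two hn
    rw [Real.rpow_natCast] at this
    exact Nat.floor_le_of_le (by exact_mod_cast this)
  exact ⟨C.extend (Nat.div_mul_le_self n L) (fun _ => hM)
    (fun _ => Nat.floor_pos.2 (one_le_two_rpow_mul hr n)), Code.extend_correct hC _ _ _⟩

/-- The rate `b / L` itself is approached only from below, by `k / (k + 1) * (b / L)`; the closure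
supplies the limit. -/
theorem mem_capacityRegion_of_codes {L b : ℕ} (hL : 0 < L)
    (hC : ∀ B : ℕ, ∃ C : Code p (B * L) fun _ => 2 ^ ((B - 1) * b), ∀ w, C.Correct w) :
    (fun _ => (b : ℝ) / L) ∈ p.capacityRegion := by
  have hL' : (0 : ℝ) < L := by exact_mod_cast hL
  have hlim : Tendsto (fun (k : ℕ) (_ : Fin 2) => (k : ℝ) / (k + 1) * (b / L)) atTop
      (𝓝 fun _ => (b : ℝ) / L) := by
    refine tendsto_pi_nhds.2 fun _ => ?_
    simpa using (tendsto_natCast_div_add_atTop (1 : ℝ)).mul_const ((b : ℝ) / L)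
  refine mem_closure_of_tendsto hlim (Eventually.of_forall fun k => ?_)
  refine achievable_of_codes hL hC (by positivity) ?_
  rcases Nat.eq_zero_or_pos b with rfl | hb
  · right; simp
  · left
    have hb' : (0 : ℝ) < b := by exact_mod_cast hb
    have hk : (k : ℝ) / (k + 1) < 1 := (div_lt_one (by positivity)).2 (by linarith)
    calc (k : ℝ) / (k + 1) * (b / L) * L = (k : ℝ) / (k + 1) * b := by field_simp
      _ < 1 * b := mul_lt_mul_of_pos_right hk hb'
      _ = b := one_mul _

end LDIRC

theorem mainTheorem9 (p : LDIRC) (hSI : p.nd < p.nc) (hs : p.nc < p.ns) :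
    (∃ (L : ℕ) (A : LDIRC.SIParams), 0 < L ∧ (2 * A.bits : ℤ) = L * p.siSumRate ∧
      ∀ B : ℕ, 0 < B → ∃ (M : Fin 2 → ℕ) (C : LDIRC.Code p (B * L) M),
        A.IsSchemeSI p L B C ∧ (∀ i, M i = 2 ^ ((B - 1) * A.bits)) ∧ C.errorProb = 0) ∧
    IsGreatest p.sumRates (p.siSumRate : ℝ) ∧
    IsLeast p.upperBoundExprs p.siSumRate ∧
    p.siSumRate = p.sumCapacityExpr := by
  obtain ⟨A, hvalid, hlay, hbits⟩ := LDIRC.SIParams.exists_optimal hSI hs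
  have hcodes := LDIRC.SIParams.exists_code hvalid hlay (by omega) two_pos
  refine ⟨⟨2, A, two_pos, by rw [hbits]; rfl, fun B _ => ?_⟩, ⟨?_, ?_⟩,
    LDIRC.siSumRate_isLeast hSI hs, LDIRC.siSumRate_eq_sumCapacityExpr hSI hs⟩
  · obtain ⟨C, hC, hcorrect⟩ := hcodes B
    exact ⟨_, C, hC, fun _ => rfl, LDIRC.Code.errorProb_eq_zero hcorrect⟩
  · refine ⟨_, LDIRC.mem_capacityRegion_of_codes two_pos
      fun B => (hcodes B).imp fun _ h => h.2, ?_⟩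
    rw [← hbits]
    push_cast
    ring
  · rintro r ⟨R, hR, rfl⟩
    exact LDIRC.sum_le_of_mem_capacityRegion hSI.le hs.le hR
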